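/- Let $\mathsf{SG}$ be the doubly-infinite Sierpinski gasket graph: let $G_0$ be the complete graph on the vertices $(0,0),(1,0),(0,1)$ of $\mathbb{Z}^2$, let $G_{k+1}$ be the union of the translates of $G_k$ by $(0,0)$, $(2^k,0)$ and $(0,2^k)$, and put $\mathsf{SG}^+=\bigcup_{k\ge 0}G_k$ and $\mathsf{SG}=\mathsf{SG}^+\cup(-\mathsf{SG}^+)$. Write $o=(0,0)$. For an integer $n$ let $B_n$ be the set of vertices at graph distance at most $n$ from $o$ (so $B_n=\emptyset$ for $n<0$), let $\partial B_n=\{u\in B_n:\ \exists v\notin B_n,\ v\sim u\}$, and let $b_n=|B_n|-\tfrac12|\partial B_n|$. For a function $f$ on the vertices of $\mathsf{SG}$ let $\Delta f(x)=\tfrac14\sum_{y\sim x}f(y)-f(x)$. In the divisible sandpile, toppling a vertex $x$ turns the sand distribution $\mu$ into $T_x\mu=\mu+\max\{\mu(x)-1,0\}\,\Delta\delta_x$. Given an initial distribution $\mu_0$ and a toppling sequence $(x_k)_{k\ge1}$, that is, a sequence that contains each vertex infinitely often, put $\mu_k=T_{x_k}\mu_{k-1}$ and let $u_k(y)=\sum_{j\le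 k:\,x_j=y}\bigl(\mu_{j-1}(y)-\mu_j(y)\bigr)$ be the mass emitted from $y$ during the first $k$ topplings. The pointwise limits of $\mu_k$ and of $u_k$, when they exist and do not depend on the toppling sequence, are the limit sand distribution and the odometer function $u$; the sandpile cluster is $\{z: u(z)>0\}$. **Theorem.** For every integer $n$, the divisible sandpile on $\mathsf{SG}$ with initial distribution $b_n\delta_o$ has a limit sand distribution $\mu$ and an odometer function (for every toppling sequence, with limits independent of the sequence), and $$\mu(z)=\begin{cases}1 & \text{if } z\in B_n\setminus\partial B_n,\\ \tfrac12 & \text{if } z\in\partial B_n,\\ 0 & \text{if } z\notin B_n.\end{cases}$$ The corresponding sandpile cluster is exactly $B_{n-1}$. -/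

import Mathlib

open Filter Topology

noncomputable section

namespace GasketSandpile

/-- Translation of the lattice by `a`, as an endomorphism of the complete graph on `ℤ × ℤ`. -/
def shift (a : ℤ × ℤ) : (⊤ : SimpleGraph (ℤ × ℤ)) →g (⊤ : SimpleGraph (ℤ × ℤ)) where
  toFun p := p + a
  map_rel' := by
    intro p q h
    simpa using h

/-- The reflection `p ↦ -p` of the lattice, as an endomorphism of the complete graph. -/
def reflect : (⊤ : SimpleGraph (ℤ × ℤ)) →g (⊤ : SimpleGraph (ℤ × ℤ)) where
  toFun p := -p
  map_rel' := by
    intro p q h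
    simpa using h

/-- The finite graphs `G_k`: `G_0` is the complete graph on `(0,0), (1,0), (0,1)`, and `G_{k+1}` is
the union of the translates of `G_k` by `(0,0)`, `(2^k,0)` and `(0,2^k)`. A graph whose vertices
are lattice points is a subgraph of the complete graph on `ℤ × ℤ`. -/
def level : ℕ → (⊤ : SimpleGraph (ℤ × ℤ)).Subgraph
  | 0 => (⊤ : (⊤ : SimpleGraph (ℤ × ℤ)).Subgraph).induce {(0, 0), (1, 0), (0, 1)}
  | k + 1 =>
      (level k).map (shift (0, 0)) ⊔ (level k).map (shift (2 ^ k, 0)) ⊔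
        (level k).map (shift (0, 2 ^ k))

/-- The one-sided Sierpinski gasket graph. -/
def gasketPos : (⊤ : SimpleGraph (ℤ × ℤ)).Subgraph := ⨆ k, level k

/-- The double-sided Sierpinski gasket graph, with its vertices as a set of lattice points. -/
def gasket : (⊤ : SimpleGraph (ℤ × ℤ)).Subgraph := gasketPos ⊔ gasketPos.map reflect

/-- The vertices of the double-sided Sierpinski gasket graph. -/
abbrev Vertex : Type := gasket.verts

/-- The double-sided Sierpinski gasket graph, on its own vertex type. -/
def SG : SimpleGraph Vertex := gasket.coe

theorem origin_mem : ((0, 0) : ℤ × ℤ) ∈ gasket.verts := by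
  have h : ((0, 0) : ℤ × ℤ) ∈ gasketPos.verts := by
    rw [gasketPos, SimpleGraph.Subgraph.verts_iSup]
    exact Set.mem_iUnion.2 ⟨0, by simp [level]⟩
  rw [gasket, SimpleGraph.Subgraph.verts_sup]
  exact Or.inl h

/-- The origin `o = (0,0)`. -/
def origin : Vertex := ⟨(0, 0), origin_mem⟩

/-- The ball `B_n` around the origin in the graph metric; it is empty for negative `n`. -/
def ball (n : ℤ) : Set Vertex := {z | (SG.dist origin z : ℤ) ≤ n}

/-- The inner boundary `∂A`. -/
def innerBoundary (A : Set Vertex) : Set Vertex := {u | u ∈ A ∧ ∃ v, v ∉ A ∧ SG.Adj u v}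

/-- `b_n = |B_n| - (1/2) |∂B_n|`. -/
def ballMass (n : ℤ) : ℝ := (ball n).ncard - 1 / 2 * (innerBoundary (ball n)).ncard

/-- The Laplacian `Δf(x) = (1/4) ∑_{y ∼ x} f(y) - f(x)`. -/
def laplacian (f : Vertex → ℝ) (x : Vertex) : ℝ :=
  1 / 4 * (∑ᶠ y ∈ SG.neighborSet x, f y) - f x

/-- The unit mass `δ_x`. -/
def pointMass (x : Vertex) : Vertex → ℝ := Pi.single x 1

/-- The toppling operator `T_x μ = μ + max {μ(x) - 1, 0} Δδ_x`, for the height function `h ≡ 1`. -/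
def topple (x : Vertex) (μ : Vertex → ℝ) : Vertex → ℝ :=
  fun y => μ y + max (μ x - 1) 0 * laplacian (pointMass x) y

/-- The sand distribution after `k` topplings; the `(k+1)`-st toppling is at the vertex `x k`. -/
def sand (μ₀ : Vertex → ℝ) (x : ℕ → Vertex) : ℕ → Vertex → ℝ
  | 0 => μ₀
  | k + 1 => topple (x k) (sand μ₀ x k)

/-- The mass emitted from `y` during the first `k` topplings. -/
def emitted (μ₀ : Vertex → ℝ) (x : ℕ → Vertex) (k : ℕ) (y : Vertex) : ℝ :=
  ∑ j ∈ Finset.range k with x j = y, (sand μ₀ x j y - sand μ₀ x (j + 1) y)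

/-- A toppling sequence contains each vertex infinitely often. -/
def IsTopplingSequence (x : ℕ → Vertex) : Prop := ∀ z, ∃ᶠ k in atTop, x k = z

/-- `μ` is the limit sand distribution of the divisible sandpile started from `μ₀`: for every
toppling sequence the sand distributions converge pointwise to `μ`. -/
def IsLimitSand (μ₀ μ : Vertex → ℝ) : Prop :=
  ∀ x, IsTopplingSequence x → ∀ z, Tendsto (fun k => sand μ₀ x k z) atTop (𝓝 (μ z))

/-- `u` is the odometer function of the divisible sandpile started from `μ₀`: for every toppling
sequence the emitted masses converge pointwise to `u`. -/
def IsOdometer (μ₀ u : Vertex → ℝ) : Prop :=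
  ∀ x, IsTopplingSequence x → ∀ z, Tendsto (fun k => emitted μ₀ x k z) atTop (𝓝 (u z))

/-- The sandpile cluster belonging to the odometer function `u`. -/
def cluster (u : Vertex → ℝ) : Set Vertex := {z | 0 < u z}

open Classical in
/-- The sand distribution equal to `1` on `B_n ∖ ∂B_n`, to `1/2` on `∂B_n`, and to `0` elsewhere. -/
def finalSand (n : ℤ) (z : Vertex) : ℝ :=
  if z ∈ ball n then (if z ∈ innerBoundary (ball n) then 1 / 2 else 1) else 0

end GasketSandpile

end

/-! It suffices to exhibit a function `u ≥ 0` that is positive exactly on $B_{n-1}$ and satisfies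
$b_n\delta_o+\Delta u=$ `finalSand n`. Such a `u` stabilizes the sandpile, and the final height is 1
wherever `u > 0`. By least action the emitted masses stay below `u`, so they increase to some `v ≤
u`. The difference `u - v` is subharmonic where it is positive, so the maximum principle on the
connected graph gives `v = u` (`isLimitSand_and_isOdometer`).

The construction of `u` rests on a charge picture. Every vertex lies in exactly two triangles, and
the distance to the origin is `|x + y|`. Hence `finalSand n z` is half the number of triangles at
`z` inside the ball (`finalSand_eq_cellCount`): the target is a uniform charge on triangles, which
can be treated one level at a time. `exists_layer` solves the problem for the triangles between
levels `j` and `j + 1`, up to a point charge at the origin, by recursion on the gasket. Two outer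
copies carry the solution for a smaller `j`, and the inner copy carries a harmonic function whose
corner fluxes absorb the point charges of the outer copies (`exists_harmonic`). Summing over `j < n`
and reflecting through the origin gives `u`. The charge at the origin has to be $b_n$ because the
total charge is zero.

Laplacians of functions on `G_k` are handled weakly, as energy sums against an arbitrary test
function `h`. The sums are additive over triangles, so gluing copies needs only agreement at the
junctions. Taking `h` a unit mass recovers pointwise values, and `h = 1` gives the mass balance. -/

namespace GasketSandpile

/-! ### Triangles of `G_k` and energy sums over them. -/

/-- The lower-left corners of the triangles of `G_k`. -/
def cells : ℕ → Finset (ℤ × ℤ)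
  | 0 => {0}
  | k + 1 => cells k ∪ (cells k).image (· + (2 ^ k, 0)) ∪ (cells k).image (· + (0, 2 ^ k))

theorem cells_bound {k : ℕ} : ∀ {t : ℤ × ℤ}, t ∈ cells k → 0 ≤ t.1 ∧ 0 ≤ t.2 ∧ t.1 + t.2 < 2 ^ k := by
  induction k with
  | zero => intro t ht; simp [cells] at ht; simp [ht]
  | succ k ih =>
    intro t ht
    have h2 : (2 : ℤ) ^ (k + 1) = 2 ^ k + 2 ^ k := by ring
    have h3 : (0 : ℤ) < 2 ^ k := by positivity
    simp only [cells, Finset.mem_union, Finset.mem_image] at ht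
    rcases ht with (ht | ⟨s, hs, rfl⟩) | ⟨s, hs, rfl⟩
    · have := ih ht
      omega
    · have := ih hs
      simp only [Prod.fst_add, Prod.snd_add]
      omega
    · have := ih hs
      simp only [Prod.fst_add, Prod.snd_add]
      omega

theorem mem_cells_succ {k : ℕ} {t : ℤ × ℤ} : t ∈ cells (k + 1) ↔
    t ∈ cells k ∨ t - (2 ^ k, 0) ∈ cells k ∨ t - (0, 2 ^ k) ∈ cells k := by
  simp only [cells, Finset.mem_union, Finset.mem_image, or_assoc]
  have key : ∀ v : ℤ × ℤ, (∃ a ∈ cells k, a + v = t) ↔ t - v ∈ cells k := by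
    intro v
    constructor
    · rintro ⟨a, ha, rfl⟩
      simpa using ha
    · intro h
      exact ⟨_, h, by simp⟩
  rw [key, key]

theorem sum_cells_succ (k : ℕ) (g : ℤ × ℤ → ℝ) : ∑ t ∈ cells (k + 1), g t =
    ∑ t ∈ cells k, g t + ∑ t ∈ cells k, g (t + (2 ^ k, 0)) + ∑ t ∈ cells k, g (t + (0, 2 ^ k)) := by
  have h3 : (0 : ℤ) < 2 ^ k := by positivity
  rw [cells, Finset.sum_union, Finset.sum_union, Finset.sum_image, Finset.sum_image]
  · intro a _ b _ h
    simpa using h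
  · intro a _ b _ h
    simpa using h
  · rw [Finset.disjoint_left]
    rintro t ht hs
    simp only [Finset.mem_image] at hs
    obtain ⟨s, hs, rfl⟩ := hs
    have h1 := cells_bound ht
    have h2 := cells_bound hs
    simp only [Prod.fst_add, Prod.snd_add] at h1
    omega
  · rw [Finset.disjoint_left]
    rintro t ht hs
    simp only [Finset.mem_image, Finset.mem_union] at hs ht
    obtain ⟨s, hs, rfl⟩ := hs
    have h2 := cells_bound hs
    rcases ht with ht | ⟨r, hr, hrs⟩
    · have h1 := cells_bound ht
      simp only [Prod.fst_add, Prod.snd_add] at h1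
      omega
    · have h1 := cells_bound hr
      simp only [Prod.ext_iff, Prod.fst_add, Prod.snd_add] at hrs
      omega

/-- The Dirichlet form of the triangle with lower-left corner `t`, with opposite sign. -/
def cellForm (f h : ℤ × ℤ → ℝ) (t : ℤ × ℤ) : ℝ :=
  h t * (f (t + (1, 0)) + f (t + (0, 1)) - 2 * f t) +
    h (t + (1, 0)) * (f t + f (t + (0, 1)) - 2 * f (t + (1, 0))) +
    h (t + (0, 1)) * (f t + f (t + (1, 0)) - 2 * f (t + (0, 1)))

/-- The sum of a function over the corners of a triangle. -/
def cellSum (h : ℤ × ℤ → ℝ) (t : ℤ × ℤ) : ℝ := h t + h (t + (1, 0)) + h (t + (0, 1))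

theorem cellForm_congr {f g h : ℤ × ℤ → ℝ} {k : ℕ} {t : ℤ × ℤ} (ht : t ∈ cells k)
    (hfg : ∀ p : ℤ × ℤ, 0 ≤ p.1 → 0 ≤ p.2 → p.1 + p.2 ≤ 2 ^ k → f p = g p) :
    cellForm f h t = cellForm g h t := by
  have hb := cells_bound ht
  simp only [cellForm]
  rw [hfg t (by omega) (by omega) (by omega),
    hfg (t + (1, 0)) (by simp only [Prod.fst_add]; omega) (by simp only [Prod.snd_add]; omega)
      (by simp only [Prod.fst_add, Prod.snd_add]; omega),
    hfg (t + (0, 1)) (by simp only [Prod.fst_add]; omega) (by simp only [Prod.snd_add]; omega)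
      (by simp only [Prod.fst_add, Prod.snd_add]; omega)]

theorem cellForm_translate (f h : ℤ × ℤ → ℝ) (t v : ℤ × ℤ) :
    cellForm f h (t + v) = cellForm (fun p => f (p + v)) (fun p => h (p + v)) t := by
  simp only [cellForm, add_right_comm]

theorem cellSum_translate (h : ℤ × ℤ → ℝ) (t v : ℤ × ℤ) :
    cellSum h (t + v) = cellSum (fun p => h (p + v)) t := by
  simp only [cellSum, add_right_comm]

/-- The energy sum of `G_{k+1}` for a function glued from functions on the three copies of `G_k`. -/
theorem sum_cellForm_glue {k : ℕ} {f f₀ f₁ f₂ h : ℤ × ℤ → ℝ}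
    (h₀ : ∀ p : ℤ × ℤ, 0 ≤ p.1 → 0 ≤ p.2 → p.1 + p.2 ≤ 2 ^ k → f p = f₀ p)
    (h₁ : ∀ p : ℤ × ℤ, 0 ≤ p.1 → 0 ≤ p.2 → p.1 + p.2 ≤ 2 ^ k → f (p + (2 ^ k, 0)) = f₁ p)
    (h₂ : ∀ p : ℤ × ℤ, 0 ≤ p.1 → 0 ≤ p.2 → p.1 + p.2 ≤ 2 ^ k → f (p + (0, 2 ^ k)) = f₂ p) :
    ∑ t ∈ cells (k + 1), cellForm f h t = ∑ t ∈ cells k, cellForm f₀ h t +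
      ∑ t ∈ cells k, cellForm f₁ (fun p => h (p + (2 ^ k, 0))) t +
      ∑ t ∈ cells k, cellForm f₂ (fun p => h (p + (0, 2 ^ k))) t := by
  rw [sum_cells_succ]
  congr 1
  · congr 1
    · exact Finset.sum_congr rfl fun t ht => cellForm_congr ht h₀
    · refine Finset.sum_congr rfl fun t ht => ?_
      rw [cellForm_translate]
      exact cellForm_congr ht h₁
  · refine Finset.sum_congr rfl fun t ht => ?_
    rw [cellForm_translate]
    exact cellForm_congr ht h₂

/-! ### Harmonic extension and the one-sided potential. -/

theorem eq_of_corner₁ {m : ℤ} {p : ℤ × ℤ} (h2 : 0 ≤ p.2) (h : p.1 + p.2 ≤ m) (hm : m ≤ p.1) :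
    p = (m, 0) := Prod.ext (by simp only; omega) (by simp only; omega)

theorem eq_of_corner₂ {m : ℤ} {p : ℤ × ℤ} (h1 : 0 ≤ p.1) (h : p.1 + p.2 ≤ m) (hm : m ≤ p.2) :
    p = (0, m) := Prod.ext (by simp only; omega) (by simp only; omega)

/-- Harmonic extension from the three corners of `G_k`, with the fluxes at the corners. -/
theorem exists_harmonic (k : ℕ) : ∀ A B C : ℝ, ∃ φ : ℤ × ℤ → ℝ,
    φ 0 = A ∧ φ (2 ^ k, 0) = B ∧ φ (0, 2 ^ k) = C ∧
    (∀ L, L ≤ A → L ≤ B → L ≤ C → ∀ p, L ≤ φ p) ∧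
    ∀ h, ∑ t ∈ cells k, cellForm φ h t = (3 / 5) ^ k * ((B + C - 2 * A) * h 0 +
      (A + C - 2 * B) * h (2 ^ k, 0) + (A + B - 2 * C) * h (0, 2 ^ k)) := by
  induction k with
  | zero =>
    intro A B C
    refine ⟨fun p => if p = 0 then A else if p = (1, 0) then B else C, by simp, ?_, ?_, ?_, ?_⟩
    · simp [Prod.ext_iff]
    · simp [Prod.ext_iff]
    · intro L hA hB hC p
      dsimp only
      split_ifs <;> assumption
    · intro h
      simp [cells, cellForm, Prod.ext_iff]
      ring
  | succ k ih =>
    intro A B C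
    have h3 : (0 : ℤ) < 2 ^ k := by positivity
    have h2 : (2 : ℤ) ^ (k + 1) = 2 ^ k + 2 ^ k := by ring
    -- The 2/5–2/5–1/5 rule: with these junction values the fluxes of the two copies meeting at a
    -- junction cancel, and each corner flux is multiplied by 3/5.
    obtain ⟨φ₀, a₀, b₀, c₀, l₀, e₀⟩ := ih A ((2 * A + 2 * B + C) / 5) ((2 * A + B + 2 * C) / 5)
    obtain ⟨φ₁, a₁, b₁, c₁, l₁, e₁⟩ := ih ((2 * A + 2 * B + C) / 5) B ((A + 2 * B + 2 * C) / 5)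
    obtain ⟨φ₂, a₂, b₂, c₂, l₂, e₂⟩ := ih ((2 * A + B + 2 * C) / 5) ((A + 2 * B + 2 * C) / 5) C
    generalize (2 : ℤ) ^ (k + 1) = M at *
    subst h2
    generalize hm : (2 : ℤ) ^ k = m at *
    refine ⟨fun p => if m ≤ p.1 then φ₁ (p - (m, 0)) else
      if m ≤ p.2 then φ₂ (p - (0, m)) else φ₀ p, ?_, ?_, ?_, ?_, ?_⟩
    · simp [a₀, h3.not_ge]
    · simp [← b₁, h3.le]
    · simp [← c₂, h3.le, h3]
    · intro L hA hB hC p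
      dsimp only
      split_ifs
      · exact l₁ L (by linarith) (by linarith) (by linarith) _
      · exact l₂ L (by linarith) (by linarith) (by linarith) _
      · exact l₀ L (by linarith) (by linarith) (by linarith) _
    · intro h
      rw [sum_cellForm_glue (f₀ := φ₀) (f₁ := φ₁) (f₂ := φ₂), e₀, e₁, e₂]
      · simp [hm, pow_succ]
        ring
      all_goals
        intro p p1 p2 p3
        rw [hm] at *
      · by_cases c1 : m ≤ p.1
        · obtain rfl := eq_of_corner₁ p2 p3 c1
          simp only [le_refl, if_true, sub_self]
          rw [a₁, b₀]
        by_cases c2 : m ≤ p.2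
        · obtain rfl := eq_of_corner₂ p1 p3 c2
          simp only [le_refl, if_true, sub_self, h3.not_ge, if_false]
          rw [a₂, c₀]
        simp [c1, c2]
      · simp [p1]
      · by_cases c1 : m ≤ p.1
        · obtain rfl := eq_of_corner₁ p2 p3 c1
          simp [b₂, ← c₁]
        simp [c1, p2]

/-- A function supported on the levels `≤ j` of `G_k` whose Laplacian is, up to a multiple of the
unit mass at the origin, the uniform charge of the triangles between the levels `j` and `j+1`. -/
theorem exists_layer (k : ℕ) : ∀ j : ℤ, 0 ≤ j → j < 2 ^ k → ∃ (W : ℤ × ℤ → ℝ) (β : ℝ), 0 ≤ β ∧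
    (∀ p : ℤ × ℤ, j < p.1 + p.2 → W p = 0) ∧ (∀ p : ℤ × ℤ, p.1 + p.2 ≤ j → 2 ≤ W p) ∧
    ∀ h, ∑ t ∈ cells k, cellForm W h t =
      2 * ∑ t ∈ cells k, (if t.1 + t.2 = j then cellSum h t else 0) - β * h 0 := by
  induction k with
  | zero =>
    intro j hj hj1
    obtain rfl : j = 0 := by simp at hj1; omega
    -- The single triangle carries charge 2 at each of three corners, so the compensating charge at
    -- the origin is 6.
    refine ⟨fun p => if 0 < p.1 + p.2 then 0 else 2, 6, by norm_num, ?_, ?_, ?_⟩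
    · intro p hp
      simp [hp]
    · intro p hp
      simp [hp.not_gt]
    · intro h
      simp [cells, cellForm, cellSum]
      ring
  | succ k ih =>
    intro j hj hjk
    have h3 : (0 : ℤ) < 2 ^ k := by positivity
    have h2 : (2 : ℤ) ^ (k + 1) = 2 ^ k + 2 ^ k := by ring
    rcases lt_or_ge j (2 ^ k) with hlt | hge
    -- The outer copies start at level `2 ^ k > j`, where `W` already vanishes, so extension by zero
    -- works.
    · obtain ⟨W, β, hβ, W0, W2, We⟩ := ih j hj hlt
      refine ⟨W, β, hβ, W0, W2, fun h => ?_⟩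
      have hz : ∀ h, ∑ t ∈ cells k, cellForm (fun _ => 0) h t = 0 := fun h =>
        Finset.sum_eq_zero fun t _ => by simp [cellForm]
      rw [sum_cellForm_glue (f₀ := W) (f₁ := fun _ => 0) (f₂ := fun _ => 0) (fun p _ _ _ => rfl),
        hz, hz, We, sum_cells_succ, add_zero, add_zero]
      · congr 2
        rw [add_assoc]
        symm
        refine add_eq_left.2 ?_
        rw [Finset.sum_eq_zero, Finset.sum_eq_zero, add_zero]
        all_goals
          intro t ht
          have := cells_bound ht
          rw [if_neg]
          simp only [Prod.fst_add, Prod.snd_add]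
          omega
      · intro p p1 p2 p3
        exact W0 _ (by simp only [Prod.fst_add, Prod.snd_add]; omega)
      · intro p p1 p2 p3
        exact W0 _ (by simp only [Prod.fst_add, Prod.snd_add]; omega)
    · obtain ⟨W, β, hβ, W0, W2, We⟩ := ih (j - 2 ^ k) (by omega) (by omega)
      have hs : 2 ≤ W 0 := W2 0 (by simp; omega)
      have hA : W 0 ≤ W 0 + (5 / 3) ^ k * β := by
        have : 0 ≤ (5 / 3 : ℝ) ^ k * β := by positivity
        linarith
      -- The outer copies leave a charge `-β` at each junction. A harmonic function with equal
      -- values at the junctions has flux `(3/5)^k` times the drop from the origin there, so a drop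
      -- of `(5/3)^k * β` cancels both charges and moves `-2 * β` to the origin.
      obtain ⟨φ, φa, φb, φc, φl, φe⟩ := exists_harmonic k (W 0 + (5 / 3) ^ k * β) (W 0) (W 0)
      refine ⟨fun p => if j < p.1 + p.2 then 0 else if 2 ^ k ≤ p.1 then W (p - (2 ^ k, 0)) else
        if 2 ^ k ≤ p.2 then W (p - (0, 2 ^ k)) else φ p, 2 * β, by positivity, ?_, ?_, ?_⟩
      · intro p hp
        simp only [hp, if_true]
      · intro p hp
        simp only [hp.not_gt, if_false]
        split_ifs
        · exact W2 _ (by simp only [Prod.fst_sub, Prod.snd_sub]; omega)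
        · exact W2 _ (by simp only [Prod.fst_sub, Prod.snd_sub]; omega)
        · exact hs.trans (φl _ hA le_rfl le_rfl p)
      · intro h
        rw [sum_cellForm_glue (f₀ := φ) (f₁ := W) (f₂ := W), φe, We, We, sum_cells_succ]
        · have hd : (3 / 5 : ℝ) ^ k * (5 / 3) ^ k = 1 := by
            rw [← mul_pow]; norm_num
          have e0 : ∑ t ∈ cells k, (if t.1 + t.2 = j then cellSum h t else 0) = 0 :=
            Finset.sum_eq_zero fun t ht => by
              have := cells_bound ht
              rw [if_neg (by omega)]
          have c1 : ∀ t : ℤ × ℤ, t.1 + 2 ^ k + t.2 = j ↔ t.1 + t.2 = j - 2 ^ k := by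
            intro t; omega
          have c2 : ∀ t : ℤ × ℤ, t.1 + (t.2 + 2 ^ k) = j ↔ t.1 + t.2 = j - 2 ^ k := by
            intro t; omega
          simp only [e0, Prod.fst_add, Prod.snd_add, add_zero, zero_add, cellSum_translate, c1, c2]
          linear_combination (β * h (2 ^ k, 0) + β * h (0, 2 ^ k) - 2 * β * h 0) * hd
        all_goals intro p p1 p2 p3
        · have : ¬ j < p.1 + p.2 := by omega
          by_cases c1 : 2 ^ k ≤ p.1
          · obtain rfl := eq_of_corner₁ p2 p3 c1
            simp only [this, if_false, le_refl, if_true, sub_self]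
            rw [φb]
          by_cases c2 : 2 ^ k ≤ p.2
          · obtain rfl := eq_of_corner₂ p1 p3 c2
            simp only [this, if_false, le_refl, if_true, sub_self, h3.not_ge]
            rw [φc]
          simp only [this, c1, c2, if_false]
        · simp only [Prod.fst_add, Prod.snd_add, add_zero]
          split_ifs with i1 i2
          · exact (W0 _ (by omega)).symm
          · simp
          · omega
          · omega
        · simp only [Prod.fst_add, Prod.snd_add, add_zero]
          split_ifs with i1 i2 i3
          · exact (W0 _ (by omega)).symm
          · obtain rfl := eq_of_corner₁ p2 p3 i2
            simp only at i1
            rw [W0 (2 ^ k, 0) (by simp only; omega), W0 _ (by simp; omega)]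
          · simp
          · omega

/-- The one-sided odometer: its Laplacian is the charge of the triangles below level `n`, up to a
multiple of the unit mass at the origin. -/
theorem exists_potential (k n : ℕ) (hn : (n : ℤ) ≤ 2 ^ k) : ∃ (V : ℤ × ℤ → ℝ) (β : ℝ),
    (∀ p : ℤ × ℤ, (n : ℤ) ≤ p.1 + p.2 → V p = 0) ∧ (∀ p : ℤ × ℤ, p.1 + p.2 < n → 0 < V p) ∧
    ∀ h, ∑ t ∈ cells k, cellForm V h t =
      2 * ∑ t ∈ cells k, (if t.1 + t.2 < n then cellSum h t else 0) - β * h 0 := by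
  induction n with
  | zero =>
    -- The zero function on `G_k`; the value 1 at negative levels only serves the positivity clause,
    -- which ranges over the whole lattice.
    refine ⟨fun p => if 0 ≤ p.1 + p.2 then 0 else 1, 0, ?_, ?_, ?_⟩
    · intro p hp
      simpa using hp
    · intro p hp
      have : ¬ 0 ≤ p.1 + p.2 := by simpa using hp
      simp only [this, if_false, zero_lt_one]
    · intro h
      rw [Finset.sum_eq_zero, Finset.sum_eq_zero]
      · simp
      · intro t ht
        have := cells_bound ht
        rw [if_neg]
        push_cast
        omega
      · intro t ht
        have := cells_bound ht
        rw [cellForm_congr (g := fun _ => 0) ht]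
        · simp [cellForm]
        · intro p p1 p2 _
          simp [add_nonneg p1 p2]
  | succ n ih =>
    push_cast at hn
    obtain ⟨V, β, V0, V2, Ve⟩ := ih (by omega)
    obtain ⟨W, γ, _, W0, W2, We⟩ := exists_layer k n (by omega) (by omega)
    refine ⟨fun p => V p + W p, β + γ, ?_, ?_, ?_⟩
    · intro p hp
      push_cast at hp
      simp only
      rw [V0 p (by omega), W0 p (by omega), add_zero]
    · intro p hp
      push_cast at hp
      have h1 := W2 p (by omega)
      have h2 : 0 ≤ V p := by
        rcases lt_or_ge (p.1 + p.2) (n : ℤ) with h | h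
        · exact (V2 p h).le
        · exact (V0 p h).ge
      simp only
      linarith
    · intro h
      have hsplit : ∀ t, cellForm (fun p => V p + W p) h t = cellForm V h t + cellForm W h t := by
        intro t
        simp only [cellForm]
        ring
      have hite : ∀ t : ℤ × ℤ, (if t.1 + t.2 < ((n + 1 : ℕ) : ℤ) then cellSum h t else 0) =
          (if t.1 + t.2 < n then cellSum h t else 0) +
            (if t.1 + t.2 = n then cellSum h t else 0) := by
        intro t
        push_cast
        split_ifs <;> first | omega | simp
      simp only [hsplit, hite, Finset.sum_add_distrib, Ve, We]
      ring


/-! ### The gasket graph in terms of its triangles. -/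

/-- `p` is a corner of the triangle with lower-left corner `t`. -/
def IsCorner (t p : ℤ × ℤ) : Prop := p = t ∨ p = t + (1, 0) ∨ p = t + (0, 1)

theorem isCorner_translate {t p v : ℤ × ℤ} : IsCorner (t + v) (p + v) ↔ IsCorner t p := by
  simp only [IsCorner, add_right_comm t v, add_left_inj]

theorem level_verts (k : ℕ) : ∀ p, p ∈ (level k).verts ↔ ∃ t ∈ cells k, IsCorner t p := by
  induction k with
  | zero =>
    intro p
    simp [level, cells, IsCorner, Prod.ext_iff]
  | succ k ih =>
    intro p
    have key : ∀ v : ℤ × ℤ, p ∈ ((level k).map (shift v)).verts ↔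
        ∃ t ∈ cells k, IsCorner (t + v) p := by
      intro v
      simp only [SimpleGraph.Subgraph.map_verts, Set.mem_image, ih]
      constructor
      · rintro ⟨q, ⟨t, ht, hq⟩, rfl⟩
        exact ⟨t, ht, isCorner_translate.2 hq⟩
      · rintro ⟨t, ht, hq⟩
        refine ⟨p - v, ⟨t, ht, ?_⟩, sub_add_cancel p v⟩
        rw [← isCorner_translate (v := v), sub_add_cancel]
        exact hq
    simp only [level, SimpleGraph.Subgraph.verts_sup, Set.mem_union, key, mem_cells_succ]
    constructor
    · rintro ((⟨t, ht, h⟩ | ⟨t, ht, h⟩) | ⟨t, ht, h⟩)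
      · exact ⟨_, Or.inl ht, by simpa [Prod.mk_zero_zero] using h⟩
      · exact ⟨_, Or.inr (Or.inl (by simpa using ht)), h⟩
      · exact ⟨_, Or.inr (Or.inr (by simpa using ht)), h⟩
    · rintro ⟨t, ht | ht | ht, h⟩
      · exact Or.inl (Or.inl ⟨t, ht, by simpa [Prod.mk_zero_zero] using h⟩)
      · exact Or.inl (Or.inr ⟨_, ht, by simpa using h⟩)
      · exact Or.inr ⟨_, ht, by simpa using h⟩

theorem level_adj (k : ℕ) : ∀ p q, (level k).Adj p q ↔
    p ≠ q ∧ ∃ t ∈ cells k, IsCorner t p ∧ IsCorner t q := by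
  induction k with
  | zero =>
    intro p q
    simp only [level, cells, IsCorner, Finset.mem_singleton, exists_eq_left, zero_add,
      SimpleGraph.Subgraph.induce_adj, SimpleGraph.Subgraph.top_adj, SimpleGraph.top_adj,
      Set.mem_insert_iff, Set.mem_singleton_iff]
    simp only [Prod.ext_iff, Prod.fst_zero, Prod.snd_zero]
    tauto
  | succ k ih =>
    intro p q
    have key : ∀ v : ℤ × ℤ, ((level k).map (shift v)).Adj p q ↔
        p ≠ q ∧ ∃ t ∈ cells k, IsCorner (t + v) p ∧ IsCorner (t + v) q := by
      intro v
      simp only [SimpleGraph.Subgraph.map_adj, Relation.Map, ih]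
      constructor
      · rintro ⟨a, b, ⟨hab, t, ht, ha, hb⟩, rfl, rfl⟩
        refine ⟨fun h => hab (add_right_cancel h), t, ht, isCorner_translate.2 ha,
          isCorner_translate.2 hb⟩
      · rintro ⟨hpq, t, ht, ha, hb⟩
        refine ⟨p - v, q - v, ⟨fun h => hpq (by simpa using h), t, ht, ?_, ?_⟩,
          sub_add_cancel p v, sub_add_cancel q v⟩
        · rw [← isCorner_translate (v := v), sub_add_cancel]
          exact ha
        · rw [← isCorner_translate (v := v), sub_add_cancel]
          exact hb
    simp only [level, SimpleGraph.Subgraph.sup_adj, key, mem_cells_succ]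
    constructor
    · rintro ((⟨hn, t, ht, h⟩ | ⟨hn, t, ht, h⟩) | ⟨hn, t, ht, h⟩)
      · exact ⟨hn, _, Or.inl ht, by simpa [Prod.mk_zero_zero] using h⟩
      · exact ⟨hn, _, Or.inr (Or.inl (by simpa using ht)), h⟩
      · exact ⟨hn, _, Or.inr (Or.inr (by simpa using ht)), h⟩
    · rintro ⟨hn, t, ht | ht | ht, h⟩
      · exact Or.inl (Or.inl ⟨hn, t, ht, by simpa [Prod.mk_zero_zero] using h⟩)
      · exact Or.inl (Or.inr ⟨hn, _, ht, by simpa using h⟩)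
      · exact Or.inr ⟨hn, _, ht, by simpa using h⟩

/-- `t` is the lower-left corner of a triangle of the one-sided gasket. -/
def IsCell (t : ℤ × ℤ) : Prop := ∃ k, t ∈ cells k

theorem IsCell.nonneg {t : ℤ × ℤ} (h : IsCell t) : 0 ≤ t.1 ∧ 0 ≤ t.2 := by
  obtain ⟨k, hk⟩ := h
  exact ⟨(cells_bound hk).1, (cells_bound hk).2.1⟩

/-- The triangles added when passing from stage `k` to stage `k + 1` all start at level at least `2
^ k`, so later stages never add anything below that level. -/
theorem mem_cells_iff {k : ℕ} {t : ℤ × ℤ} : t ∈ cells k ↔ IsCell t ∧ t.1 + t.2 < 2 ^ k := by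
  constructor
  · intro h
    exact ⟨⟨k, h⟩, (cells_bound h).2.2⟩
  · rintro ⟨⟨m, hm⟩, hlt⟩
    have mono : ∀ i, t ∈ cells (k + i) → t ∈ cells k := by
      intro i
      induction i with
      | zero => exact id
      | succ i ih =>
        intro h
        have hle : (2 : ℤ) ^ k ≤ 2 ^ (k + i) := pow_le_pow_right₀ (by norm_num) (by omega)
        rcases (mem_cells_succ (k := k + i)).1 h with h | h | h
        · exact ih h
        · have := cells_bound h
          simp only [Prod.fst_sub, Prod.snd_sub] at this
          omega
        · have := cells_bound h
          simp only [Prod.fst_sub, Prod.snd_sub] at this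
          omega
    have up : ∀ i, t ∈ cells (m + i) := by
      intro i
      induction i with
      | zero => exact hm
      | succ i ih => exact mem_cells_succ.2 (Or.inl ih)
    exact mono m (by rw [add_comm]; exact up k)

/-- The recursive definition prepends a highest binary digit; this form strips the lowest one.
Triangles correspond to pairs whose binary digits are never both 1, which makes local questions
accessible by parity. -/
theorem mem_cells_succ_iff_half {k : ℕ} : ∀ {t : ℤ × ℤ}, t ∈ cells (k + 1) ↔
    (t.1 / 2, t.2 / 2) ∈ cells k ∧ (t.1 % 2 = 0 ∨ t.2 % 2 = 0) := by
  induction k with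
  | zero =>
    intro t
    rw [mem_cells_succ]
    simp only [cells, Finset.mem_singleton, Prod.ext_iff, Prod.fst_sub,
      Prod.snd_sub, Prod.fst_zero, Prod.snd_zero, pow_zero]
    omega
  | succ k ih =>
    intro t
    have h2 : (2 : ℤ) ^ (k + 1) = 2 * 2 ^ k := by ring
    have e1 : (t.1 - 2 ^ (k + 1)) / 2 = t.1 / 2 - 2 ^ k := by omega
    have e2 : (t.2 - 2 ^ (k + 1)) / 2 = t.2 / 2 - 2 ^ k := by omega
    have e3 : (t.1 - 2 ^ (k + 1)) % 2 = t.1 % 2 := by omega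
    have e4 : (t.2 - 2 ^ (k + 1)) % 2 = t.2 % 2 := by omega
    rw [mem_cells_succ (k := k + 1), ih, ih, ih, mem_cells_succ (k := k)]
    simp only [Prod.fst_sub, Prod.snd_sub, Prod.mk_sub_mk, sub_zero, e1, e2, e3, e4]
    tauto

theorem isCell_iff_half {t : ℤ × ℤ} :
    IsCell t ↔ IsCell (t.1 / 2, t.2 / 2) ∧ (t.1 % 2 = 0 ∨ t.2 % 2 = 0) := by
  constructor
  · rintro ⟨k, hk⟩
    have := mem_cells_succ_iff_half.1 (mem_cells_succ.2 (Or.inl hk))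
    exact ⟨⟨k, this.1⟩, this.2⟩
  · rintro ⟨⟨k, hk⟩, h⟩
    exact ⟨k + 1, mem_cells_succ_iff_half.2 ⟨hk, h⟩⟩

theorem isCell_zero : IsCell 0 := ⟨0, by simp [cells]⟩

/-- Every vertex other than the origin lies in exactly two triangles. -/
theorem isCell_two (N : ℕ) : ∀ x y : ℤ, x + y ≤ N → 0 ≤ x → 0 ≤ y → (x, y) ≠ 0 →
    (IsCell (x, y) ∨ IsCell (x - 1, y) ∨ IsCell (x, y - 1)) →
    (IsCell (x, y) ∧ IsCell (x - 1, y) ∧ ¬ IsCell (x, y - 1)) ∨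
    (IsCell (x, y) ∧ ¬ IsCell (x - 1, y) ∧ IsCell (x, y - 1)) ∨
    (¬ IsCell (x, y) ∧ IsCell (x - 1, y) ∧ IsCell (x, y - 1)) := by
  induction N with
  | zero =>
    intro x y h hx hy h0
    exfalso
    apply h0
    ext
    · simp; push_cast at h; omega
    · simp; push_cast at h; omega
  | succ N ih =>
    intro x y h hx hy h0 hc
    push_cast at h
    rw [isCell_iff_half (t := (x, y)), isCell_iff_half (t := (x - 1, y)),
      isCell_iff_half (t := (x, y - 1))] at hc ⊢
    simp only at hc ⊢
    have h0' : ¬ (x = 0 ∧ y = 0) := by simpa [Prod.ext_iff] using h0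
    -- If both coordinates are even, halving reduces to a smaller vertex. Otherwise one of the three
    -- candidates has two odd coordinates and drops out, while the other two have the same half.
    rcases Int.emod_two_eq_zero_or_one x with hx2 | hx2 <;>
      rcases Int.emod_two_eq_zero_or_one y with hy2 | hy2
    · have e1 : (x - 1) / 2 = x / 2 - 1 := by omega
      have e2 : (y - 1) / 2 = y / 2 - 1 := by omega
      have := ih (x / 2) (y / 2) (by omega) (by omega) (by omega)
        (by simp only [ne_eq, Prod.ext_iff, Prod.fst_zero, Prod.snd_zero]; omega)
      rw [e1, e2] at hc ⊢
      simp only [hx2, hy2, true_or, or_true, and_true] at hc ⊢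
      exact this hc
    · have e1 : (x - 1) % 2 ≠ 0 := by omega
      have e2 : (y - 1) / 2 = y / 2 := by omega
      have e3 : y % 2 ≠ 0 := by omega
      rw [e2] at hc ⊢
      simp only [hx2, e1, e3, true_or, or_self, and_true, and_false] at hc ⊢
      tauto
    · have e1 : (y - 1) % 2 ≠ 0 := by omega
      have e2 : (x - 1) / 2 = x / 2 := by omega
      have e3 : x % 2 ≠ 0 := by omega
      rw [e2] at hc ⊢
      simp only [hy2, e1, e3, or_true, or_self, and_true, and_false] at hc ⊢
      tauto
    · have e1 : (y - 1) / 2 = y / 2 := by omega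
      have e2 : (x - 1) / 2 = x / 2 := by omega
      have e3 : x % 2 ≠ 0 := by omega
      have e4 : y % 2 ≠ 0 := by omega
      have e5 : (x - 1) % 2 = 0 := by omega
      have e6 : (y - 1) % 2 = 0 := by omega
      rw [e1, e2] at hc ⊢
      simp only [e3, e4, e5, e6, or_true, or_self, and_true, and_false, true_or] at hc ⊢
      tauto

theorem gasketPos_verts {p : ℤ × ℤ} : p ∈ gasketPos.verts ↔ ∃ t, IsCell t ∧ IsCorner t p := by
  simp only [gasketPos, SimpleGraph.Subgraph.verts_iSup, Set.mem_iUnion, level_verts, IsCell]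
  tauto

theorem gasketPos_adj {p q : ℤ × ℤ} : gasketPos.Adj p q ↔
    p ≠ q ∧ ∃ t, IsCell t ∧ IsCorner t p ∧ IsCorner t q := by
  simp only [gasketPos, SimpleGraph.Subgraph.iSup_adj, level_adj, IsCell]
  tauto

theorem gasket_verts {p : ℤ × ℤ} :
    p ∈ gasket.verts ↔ p ∈ gasketPos.verts ∨ -p ∈ gasketPos.verts := by
  simp only [gasket, SimpleGraph.Subgraph.verts_sup, SimpleGraph.Subgraph.map_verts, Set.mem_union,
    Set.mem_image]
  refine or_congr Iff.rfl ⟨?_, fun h => ⟨-p, h, neg_neg p⟩⟩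
  rintro ⟨q, hq, rfl⟩
  exact (neg_neg q).symm ▸ hq

theorem gasket_adj {p q : ℤ × ℤ} :
    gasket.Adj p q ↔ gasketPos.Adj p q ∨ gasketPos.Adj (-p) (-q) := by
  simp only [gasket, SimpleGraph.Subgraph.sup_adj, SimpleGraph.Subgraph.map_adj, Relation.Map]
  refine or_congr Iff.rfl ⟨?_, fun h => ⟨-p, -q, h, neg_neg p, neg_neg q⟩⟩
  rintro ⟨a, b, h, rfl, rfl⟩
  have e : ∀ c : ℤ × ℤ, -(reflect c) = c := fun c => neg_neg c
  rw [e, e]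
  exact h

theorem gasketPos_nonneg {p : ℤ × ℤ} (h : p ∈ gasketPos.verts) : 0 ≤ p.1 ∧ 0 ≤ p.2 := by
  obtain ⟨t, ht, rfl | rfl | rfl⟩ := gasketPos_verts.1 h
  · exact ht.nonneg
  all_goals
    have := ht.nonneg
    simp only [Prod.fst_add, Prod.snd_add]
    omega

theorem gasketPos_adj_iff {p q : ℤ × ℤ} : gasketPos.Adj p q ↔
    (IsCell p ∧ (q = p + (1, 0) ∨ q = p + (0, 1))) ∨
    (IsCell (p - (1, 0)) ∧ (q = p - (1, 0) ∨ q = p - (1, 0) + (0, 1))) ∨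
    (IsCell (p - (0, 1)) ∧ (q = p - (0, 1) ∨ q = p - (0, 1) + (1, 0))) := by
  rw [gasketPos_adj]
  constructor
  · rintro ⟨hpq, t, ht, hp, hq⟩
    rcases hp with rfl | rfl | rfl <;> rcases hq with rfl | rfl | rfl <;>
      simp [ht] at hpq ⊢
  · rintro (⟨ht, hq⟩ | ⟨ht, hq⟩ | ⟨ht, hq⟩)
    · refine ⟨?_, _, ht, Or.inl rfl, Or.inr hq⟩
      rcases hq with rfl | rfl <;> simp
    · refine ⟨?_, _, ht, Or.inr (Or.inl (by simp)), ?_⟩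
      · rcases hq with rfl | rfl <;> (simp [Prod.ext_iff]; try omega)
      · rcases hq with rfl | rfl <;> simp [IsCorner]
    · refine ⟨?_, _, ht, Or.inr (Or.inr (by simp)), ?_⟩
      · rcases hq with rfl | rfl <;> (simp [Prod.ext_iff]; try omega)
      · rcases hq with rfl | rfl <;> simp [IsCorner]

theorem gasketPos_verts_iff {p : ℤ × ℤ} : p ∈ gasketPos.verts ↔
    IsCell p ∨ IsCell (p - (1, 0)) ∨ IsCell (p - (0, 1)) := by
  rw [gasketPos_verts]
  constructor
  · rintro ⟨t, ht, rfl | rfl | rfl⟩ <;> simp [ht]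
  · rintro (h | h | h)
    · exact ⟨_, h, Or.inl rfl⟩
    · exact ⟨_, h, Or.inr (Or.inl (by simp))⟩
    · exact ⟨_, h, Or.inr (Or.inr (by simp))⟩

/-- The three possible positions of a vertex other than the origin. -/
theorem gasketPos_cases {p : ℤ × ℤ} (h : p ∈ gasketPos.verts) (h0 : p ≠ 0) :
    (IsCell p ∧ IsCell (p - (1, 0)) ∧ ¬ IsCell (p - (0, 1))) ∨
    (IsCell p ∧ ¬ IsCell (p - (1, 0)) ∧ IsCell (p - (0, 1))) ∨
    (¬ IsCell p ∧ IsCell (p - (1, 0)) ∧ IsCell (p - (0, 1))) := by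
  obtain ⟨x, y⟩ := p
  have hn := gasketPos_nonneg h
  simp only at hn
  have hv := gasketPos_verts_iff.1 h
  simp only [Prod.mk_sub_mk, sub_zero] at hv ⊢
  exact isCell_two (x + y).toNat x y (by omega) hn.1 hn.2 h0 hv

theorem not_isCell_sub₁ : ¬ IsCell (0 - (1, 0)) := fun h => by
  have := h.nonneg
  simp at this

theorem not_isCell_sub₂ : ¬ IsCell (0 - (0, 1)) := fun h => by
  have := h.nonneg
  simp at this


theorem gasket_adj_neg {p q : ℤ × ℤ} : gasket.Adj (-p) (-q) ↔ gasket.Adj p q := by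
  rw [gasket_adj, gasket_adj, neg_neg, neg_neg, or_comm]

theorem isCell_pos {p : ℤ × ℤ} (h : IsCell p) : p ∈ gasketPos.verts :=
  gasketPos_verts_iff.2 (Or.inl h)

theorem eq_zero_of_gasketPos {p : ℤ × ℤ} (h : p ∈ gasketPos.verts) (h' : -p ∈ gasketPos.verts) :
    p = 0 := by
  have h1 := gasketPos_nonneg h
  have h2 := gasketPos_nonneg h'
  simp only [Prod.fst_neg, Prod.snd_neg] at h2
  ext
  · simp only [Prod.fst_zero]; omega
  · simp only [Prod.snd_zero]; omega

/-! ### The Laplacian as a sum over triangles. -/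

open Classical in
/-- The contribution of the one-sided gasket to four times the Laplacian, triangle by triangle. -/
noncomputable def cellLap (F : ℤ × ℤ → ℝ) (z : ℤ × ℤ) : ℝ :=
  (if IsCell z then F (z + (1, 0)) + F (z + (0, 1)) - 2 * F z else 0) +
  (if IsCell (z - (1, 0)) then F (z - (1, 0)) + F (z - (1, 0) + (0, 1)) - 2 * F z else 0) +
  (if IsCell (z - (0, 1)) then F (z - (0, 1)) + F (z - (0, 1) + (1, 0)) - 2 * F z else 0)

theorem cellLap_eq_zero {F : ℤ × ℤ → ℝ} {z : ℤ × ℤ} (h : z ∉ gasketPos.verts) :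
    cellLap F z = 0 := by
  rw [gasketPos_verts_iff] at h
  push Not at h
  simp [cellLap, h]

theorem sum_ite_cells (k : ℕ) (z v : ℤ × ℤ) (G : ℤ × ℤ → ℝ) :
    ∑ t ∈ cells k, (if t + v = z then G t else 0) = if z - v ∈ cells k then G (z - v) else 0 := by
  have : ∀ t, t + v = z ↔ t = z - v := fun t => eq_sub_iff_add_eq.symm
  simp only [this, Finset.sum_ite_eq']

-- Passage from the weak to the pointwise Laplacian. Below level `2 ^ k` every one-sided triangle at
-- `z` belongs to `G_k`, so nothing is lost by truncation.
open Classical in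
theorem sum_cellForm_single {k : ℕ} {z : ℤ × ℤ} (F : ℤ × ℤ → ℝ) (h : z.1 + z.2 < 2 ^ k) :
    ∑ t ∈ cells k, cellForm F (Pi.single z 1) t = cellLap F z := by
  have e : ∀ t, cellForm F (Pi.single z 1) t =
      (if t + 0 = z then F (t + (1, 0)) + F (t + (0, 1)) - 2 * F t else 0) +
      (if t + (1, 0) = z then F t + F (t + (0, 1)) - 2 * F (t + (1, 0)) else 0) +
      (if t + (0, 1) = z then F t + F (t + (1, 0)) - 2 * F (t + (0, 1)) else 0) := by
    intro t
    simp only [cellForm, Pi.single_apply, add_zero, ite_mul, one_mul, zero_mul]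
  have h1 : (z - (1, 0)).1 + (z - (1, 0)).2 < 2 ^ k := by
    simp only [Prod.fst_sub, Prod.snd_sub]; omega
  have h2 : (z - (0, 1)).1 + (z - (0, 1)).2 < 2 ^ k := by
    simp only [Prod.fst_sub, Prod.snd_sub]; omega
  simp only [e, Finset.sum_add_distrib, sum_ite_cells, cellLap, mem_cells_iff, sub_zero, h, h1, h2,
    and_true, sub_add_cancel]

theorem gasket_adj_of_pos {p q : ℤ × ℤ} (h : p ∈ gasketPos.verts) (h0 : p ≠ 0) :
    gasket.Adj p q ↔ gasketPos.Adj p q := by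
  rw [gasket_adj, or_iff_left]
  intro h'
  exact h0 (eq_zero_of_gasketPos h h'.fst_mem)

theorem gasket_adj_zero {q : ℤ × ℤ} : gasket.Adj 0 q ↔
    q = (1, 0) ∨ q = (0, 1) ∨ q = -(1, 0) ∨ q = -(0, 1) := by
  rw [gasket_adj, gasketPos_adj_iff, gasketPos_adj_iff, neg_zero]
  simp only [isCell_zero, not_isCell_sub₁, not_isCell_sub₂, true_and, false_and, or_false, zero_add,
    neg_eq_iff_eq_neg, or_assoc]

theorem sum_adj_of_pos {z : ℤ × ℤ} (F : ℤ × ℤ → ℝ) (h : z ∈ gasketPos.verts) (h0 : z ≠ 0) :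
    ∑ᶠ q ∈ {q | gasket.Adj z q}, F q = cellLap F z + 4 * F z := by
  simp only [gasket_adj_of_pos h h0, gasketPos_adj_iff]
  rcases gasketPos_cases h h0 with ⟨h1, h2, h3⟩ | ⟨h1, h2, h3⟩ | ⟨h1, h2, h3⟩
  · have : {q | (IsCell z ∧ (q = z + (1, 0) ∨ q = z + (0, 1))) ∨
        (IsCell (z - (1, 0)) ∧ (q = z - (1, 0) ∨ q = z - (1, 0) + (0, 1))) ∨
        (IsCell (z - (0, 1)) ∧ (q = z - (0, 1) ∨ q = z - (0, 1) + (1, 0)))} =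
        (({z + (1, 0), z + (0, 1), z - (1, 0), z - (1, 0) + (0, 1)} : Finset (ℤ × ℤ)) :
          Set (ℤ × ℤ)) := by
      ext q
      simp [h1, h2, h3, or_assoc]
    rw [this, finsum_mem_coe_finset, Finset.sum_insert, Finset.sum_insert, Finset.sum_insert,
      Finset.sum_singleton]
    · simp only [cellLap, h1, h2, h3, if_true, if_false]
      ring
    all_goals
      simp [Prod.ext_iff]
    all_goals omega
  · have : {q | (IsCell z ∧ (q = z + (1, 0) ∨ q = z + (0, 1))) ∨
        (IsCell (z - (1, 0)) ∧ (q = z - (1, 0) ∨ q = z - (1, 0) + (0, 1))) ∨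
        (IsCell (z - (0, 1)) ∧ (q = z - (0, 1) ∨ q = z - (0, 1) + (1, 0)))} =
        (({z + (1, 0), z + (0, 1), z - (0, 1), z - (0, 1) + (1, 0)} : Finset (ℤ × ℤ)) :
          Set (ℤ × ℤ)) := by
      ext q
      simp [h1, h2, h3, or_assoc]
    rw [this, finsum_mem_coe_finset, Finset.sum_insert, Finset.sum_insert, Finset.sum_insert,
      Finset.sum_singleton]
    · simp only [cellLap, h1, h2, h3, if_true, if_false]
      ring
    all_goals
      simp [Prod.ext_iff]
    all_goals omega
  · have : {q | (IsCell z ∧ (q = z + (1, 0) ∨ q = z + (0, 1))) ∨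
        (IsCell (z - (1, 0)) ∧ (q = z - (1, 0) ∨ q = z - (1, 0) + (0, 1))) ∨
        (IsCell (z - (0, 1)) ∧ (q = z - (0, 1) ∨ q = z - (0, 1) + (1, 0)))} =
        (({z - (1, 0), z - (1, 0) + (0, 1), z - (0, 1), z - (0, 1) + (1, 0)} :
          Finset (ℤ × ℤ)) : Set (ℤ × ℤ)) := by
      ext q
      simp [h1, h2, h3, or_assoc]
    rw [this, finsum_mem_coe_finset, Finset.sum_insert, Finset.sum_insert, Finset.sum_insert,
      Finset.sum_singleton]
    · simp only [cellLap, h1, h2, h3, if_true, if_false]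
      ring
    all_goals
      simp [Prod.ext_iff]
    all_goals omega

theorem cellLap_zero (F : ℤ × ℤ → ℝ) : cellLap F 0 = F (1, 0) + F (0, 1) - 2 * F 0 := by
  simp only [cellLap, isCell_zero, not_isCell_sub₁, not_isCell_sub₂, if_true, if_false, zero_add,
    add_zero]

/-- Each triangle at `z` subtracts `2 * F z` and there are two of them: both on one side when `z ≠
0`, one on each side at the origin. This accounts for `4 * F z`. -/
theorem sum_adj (F : ℤ × ℤ → ℝ) {z : ℤ × ℤ} (h : z ∈ gasket.verts) :
    ∑ᶠ q ∈ {q | gasket.Adj z q}, F q =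
      cellLap F z + cellLap (fun p => F (-p)) (-z) + 4 * F z := by
  by_cases h0 : z = 0
  · subst h0
    have : {q | gasket.Adj 0 q} =
        (({(1, 0), (0, 1), -(1, 0), -(0, 1)} : Finset (ℤ × ℤ)) : Set (ℤ × ℤ)) := by
      ext q
      simp [gasket_adj_zero]
    rw [this, finsum_mem_coe_finset, neg_zero, cellLap_zero, cellLap_zero, Finset.sum_insert,
      Finset.sum_insert, Finset.sum_insert, Finset.sum_singleton]
    · simp only [neg_zero]
      ring
    all_goals simp [Prod.ext_iff]
  · rcases gasket_verts.1 h with hp | hp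
    · have hn : -z ∉ gasketPos.verts := fun hn => h0 (eq_zero_of_gasketPos hp hn)
      rw [sum_adj_of_pos F hp h0, cellLap_eq_zero hn, add_zero]
    · have hn : z ∉ gasketPos.verts := fun hn => h0 (eq_zero_of_gasketPos hn hp)
      rw [cellLap_eq_zero hn, zero_add]
      have := sum_adj_of_pos (fun p => F (-p)) hp (neg_ne_zero.2 h0)
      rw [neg_neg] at this
      rw [← this]
      refine finsum_mem_eq_of_bijOn (fun q => -q) ⟨?_, ?_, ?_⟩ ?_
      · intro q hq
        exact gasket_adj_neg.2 hq
      · intro a _ b _ hab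
        exact neg_injective hab
      · intro q hq
        refine ⟨-q, ?_, neg_neg q⟩
        exact gasket_adj_neg.1 (by rw [neg_neg]; exact hq)
      · intro q _
        simp

theorem SG_adj {x y : Vertex} : SG.Adj x y ↔ gasket.Adj x.1 y.1 := Iff.rfl

theorem sum_neighborSet (F : ℤ × ℤ → ℝ) (z : Vertex) : ∑ᶠ y ∈ SG.neighborSet z, F y.1 =
    cellLap F z.1 + cellLap (fun p => F (-p)) (-z.1) + 4 * F z.1 := by
  rw [← sum_adj F z.2]
  refine finsum_mem_eq_of_bijOn Subtype.val ⟨?_, ?_, ?_⟩ fun _ _ => rfl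
  · intro q hq
    exact hq
  · intro a _ b _ hab
    exact Subtype.ext hab
  · intro q hq
    exact ⟨⟨q, (show gasket.Adj z.1 q from hq).snd_mem⟩, hq, rfl⟩

theorem laplacian_eq_cellLap (F : ℤ × ℤ → ℝ) (z : Vertex) : laplacian (fun y => F y.1) z =
    1 / 4 * (cellLap F z.1 + cellLap (fun p => F (-p)) (-z.1)) := by
  rw [laplacian, sum_neighborSet]
  ring

theorem ncard_neighborSet (z : Vertex) : (SG.neighborSet z).ncard = 4 := by
  have h := sum_neighborSet (fun _ => 1) z
  have h0 : ∀ p, cellLap (fun _ => 1) p = 0 := fun p => by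
    simp only [cellLap]
    norm_num
  rw [h0, h0] at h
  by_cases hf : (SG.neighborSet z).Finite
  · rw [finsum_mem_eq_finite_toFinset_sum _ hf, Finset.sum_const,
      ← Set.ncard_eq_toFinset_card _ hf] at h
    have h' : (((SG.neighborSet z).ncard : ℕ) : ℝ) = 4 := by simpa using h
    exact_mod_cast h'
  -- An infinite neighbour set would make the `finsum` of the constant 1 take its default value 0,
  -- contradicting the value 4.
  · rw [finsum_mem_eq_zero_of_infinite] at h
    · norm_num at h
    · have : (SG.neighborSet z ∩ Function.support fun _ : Vertex => (1 : ℝ)) =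
        SG.neighborSet z := by
        ext y
        simp
      rw [this]
      exact hf

/-- The neighbours of a vertex, as a finite set. -/
theorem exists_neighborFinset (z : Vertex) : ∃ s : Finset Vertex, s.card = 4 ∧
    (∀ y, y ∈ s ↔ SG.Adj z y) ∧ ∀ f, laplacian f z = 1 / 4 * ∑ y ∈ s, f y - f z := by
  have hc := ncard_neighborSet z
  have hf : (SG.neighborSet z).Finite := Set.finite_of_ncard_ne_zero (by rw [hc]; norm_num)
  refine ⟨hf.toFinset, ?_, ?_, ?_⟩
  · rw [← hc, Set.ncard_eq_toFinset_card _ hf]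
  · intro y
    simp
  · intro f
    rw [laplacian, finsum_mem_eq_finite_toFinset_sum _ hf]

/-! ### Distance, balls and inner boundaries. -/

/-- The signed distance to the origin. -/
def height (p : ℤ × ℤ) : ℤ := p.1 + p.2

theorem abs_height_neg (p : ℤ × ℤ) : |height (-p)| = |height p| := by
  rw [← abs_neg (height p)]
  congr 1
  simp only [height, Prod.fst_neg, Prod.snd_neg]
  omega

theorem height_adj {p q : ℤ × ℤ} (h : gasket.Adj p q) : |height q| ≤ |height p| + 1 := by
  have key : ∀ {p q : ℤ × ℤ}, gasketPos.Adj p q → |height q| ≤ |height p| + 1 := by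
    intro p q h
    have hp := gasketPos_nonneg h.fst_mem
    have hq := gasketPos_nonneg h.snd_mem
    simp only [height]
    rw [abs_of_nonneg (by omega), abs_of_nonneg (by omega)]
    rw [gasketPos_adj_iff] at h
    rcases h with ⟨_, rfl | rfl⟩ | ⟨_, rfl | rfl⟩ | ⟨_, rfl | rfl⟩ <;>
      simp only [Prod.fst_sub, Prod.snd_sub, Prod.fst_add, Prod.snd_add] <;> omega
  rcases gasket_adj.1 h with h | h
  · exact key h
  · simpa only [abs_height_neg] using key h

theorem exists_lower {z : Vertex} (hz : z.1 ≠ 0) :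
    ∃ y, SG.Adj z y ∧ |height y.1| + 1 = |height z.1| := by
  have key : ∀ p : ℤ × ℤ, p ∈ gasketPos.verts → p ≠ 0 →
      ∃ q, gasketPos.Adj p q ∧ |height q| + 1 = |height p| := by
    intro p hp h0
    have hn := gasketPos_nonneg hp
    have : IsCell (p - (1, 0)) ∨ IsCell (p - (0, 1)) := by
      have := gasketPos_cases hp h0
      tauto
    rcases this with h | h
    · have := h.nonneg
      refine ⟨_, gasketPos_adj_iff.2 (Or.inr (Or.inl ⟨h, Or.inl rfl⟩)), ?_⟩
      simp only [height]
      rw [abs_of_nonneg (by omega), abs_of_nonneg (by omega)]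
      simp only [Prod.fst_sub, Prod.snd_sub]
      omega
    · have := h.nonneg
      refine ⟨_, gasketPos_adj_iff.2 (Or.inr (Or.inr ⟨h, Or.inl rfl⟩)), ?_⟩
      simp only [height]
      rw [abs_of_nonneg (by omega), abs_of_nonneg (by omega)]
      simp only [Prod.fst_sub, Prod.snd_sub]
      omega
  rcases gasket_verts.1 z.2 with hp | hp
  · obtain ⟨q, hq, hh⟩ := key _ hp hz
    have ha : gasket.Adj z.1 q := gasket_adj.2 (Or.inl hq)
    exact ⟨⟨q, ha.snd_mem⟩, ha, hh⟩
  · obtain ⟨q, hq, hh⟩ := key _ hp (neg_ne_zero.2 hz)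
    have ha : gasket.Adj z.1 (-q) := gasket_adj.2 (Or.inr (by rw [neg_neg]; exact hq))
    exact ⟨⟨-q, ha.snd_mem⟩, ha, by rw [abs_height_neg, hh, abs_height_neg]⟩

theorem exists_walk_height (N : ℕ) : ∀ z : Vertex, |height z.1| = N →
    ∃ w : SG.Walk origin z, w.length = N := by
  induction N with
  | zero =>
    intro z hz
    by_cases h0 : z.1 = 0
    · obtain rfl : z = origin := Subtype.ext h0
      exact ⟨SimpleGraph.Walk.nil, rfl⟩
    · obtain ⟨y, _, hy⟩ := exists_lower h0
      have := abs_nonneg (height y.1)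
      push_cast at hz
      omega
  | succ N ih =>
    intro z hz
    by_cases h0 : z.1 = 0
    · rw [h0] at hz
      simp [height] at hz
      omega
    · obtain ⟨y, ha, hy⟩ := exists_lower h0
      obtain ⟨w, hw⟩ := ih y (by push_cast at hz; omega)
      exact ⟨w.concat ha.symm, by simp [hw]⟩

theorem height_le_length {x y : Vertex} (w : SG.Walk x y) :
    |height y.1| ≤ |height x.1| + w.length := by
  induction w with
  | nil => simp
  | cons h w ih =>
    have := height_adj h
    simp only [SimpleGraph.Walk.length_cons]
    push_cast
    omega

theorem connected_SG : SG.Connected := by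
  have h : ∀ z, SG.Reachable origin z := fun z =>
    ⟨(exists_walk_height (height z.1).natAbs z (by simp)).choose⟩
  have : Nonempty Vertex := ⟨origin⟩
  exact ⟨fun x y => (h x).symm.trans (h y)⟩

/-- An edge changes `|height|` by at most 1, and every vertex except the origin has a neighbour that
is one lower. -/
theorem dist_origin (z : Vertex) : (SG.dist origin z : ℤ) = |height z.1| := by
  apply le_antisymm
  · obtain ⟨w, hw⟩ := exists_walk_height (height z.1).natAbs z (by simp)
    have := SimpleGraph.dist_le w
    rw [hw] at this
    rw [Int.abs_eq_natAbs]
    exact_mod_cast this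
  · obtain ⟨w, hw⟩ := connected_SG.exists_walk_length_eq_dist origin z
    have := height_le_length w
    rw [hw] at this
    simpa [height, origin] using this

theorem mem_ball {n : ℤ} {z : Vertex} : z ∈ ball n ↔ |height z.1| ≤ n := by
  rw [ball, Set.mem_ofPred_eq, dist_origin]

theorem finite_ball (n : ℤ) : (ball n).Finite := by
  have : Set.Finite (Set.Icc ((-n, -n) : ℤ × ℤ) (n, n)) := Set.finite_Icc _ _
  refine (this.preimage Subtype.val_injective.injOn).subset ?_
  intro z hz
  rw [mem_ball, abs_le, height] at hz
  rw [Set.mem_preimage, Set.mem_Icc, Prod.le_def, Prod.le_def]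
  rcases gasket_verts.1 z.2 with h | h
  · have := gasketPos_nonneg h
    simp only
    omega
  · have := gasketPos_nonneg h
    simp only [Prod.fst_neg, Prod.snd_neg] at this
    simp only
    omega

/-- Only the lower-left corner of a triangle has neighbours further out within it. A vertex at
distance `n` whose two triangles both point back towards the origin is therefore not a boundary
point. -/
theorem mem_innerBoundary_ball {n : ℤ} (hn : 0 ≤ n) {z : Vertex} :
    z ∈ innerBoundary (ball n) ↔ |height z.1| = n ∧ (IsCell z.1 ∨ IsCell (-z.1)) := by
  have key : ∀ p q : ℤ × ℤ, gasketPos.Adj p q → |height p| ≤ n → n < |height q| →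
      |height p| = n ∧ IsCell p := by
    intro p q h hp hq
    have h1 := gasketPos_nonneg h.fst_mem
    have h2 := gasketPos_nonneg h.snd_mem
    simp only [height] at *
    rw [abs_of_nonneg (by omega)] at hp hq ⊢
    rw [gasketPos_adj_iff] at h
    rcases h with ⟨hc, rfl | rfl⟩ | ⟨_, rfl | rfl⟩ | ⟨_, rfl | rfl⟩ <;>
      simp only [Prod.fst_sub, Prod.snd_sub, Prod.fst_add, Prod.snd_add] at hq <;>
      first | omega | exact ⟨by omega, hc⟩
  constructor
  · rintro ⟨hz, y, hy, ha⟩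
    rw [mem_ball] at hz hy
    rcases gasket_adj.1 ha with h | h
    · have := key _ _ h hz (by omega)
      exact ⟨this.1, Or.inl this.2⟩
    · have := key _ _ h (by rw [abs_height_neg]; exact hz) (by rw [abs_height_neg]; omega)
      exact ⟨by rw [← this.1, abs_height_neg], Or.inr this.2⟩
  · rintro ⟨hz, hc⟩
    refine ⟨mem_ball.2 hz.le, ?_⟩
    rcases hc with hc | hc
    · have ha : gasket.Adj z.1 (z.1 + (1, 0)) :=
        gasket_adj.2 (Or.inl (gasketPos_adj_iff.2 (Or.inl ⟨hc, Or.inl rfl⟩)))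
      refine ⟨⟨_, ha.snd_mem⟩, ?_, ha⟩
      have := hc.nonneg
      rw [height, abs_of_nonneg (by omega)] at hz
      rw [mem_ball, height]
      simp only [Prod.fst_add, Prod.snd_add]
      rw [abs_of_nonneg (by omega)]
      omega
    · have ha : gasket.Adj z.1 (-(-z.1 + (1, 0))) :=
        gasket_adj.2 (Or.inr (gasketPos_adj_iff.2 (Or.inl ⟨hc, Or.inl (neg_neg _)⟩)))
      refine ⟨⟨_, ha.snd_mem⟩, ?_, ha⟩
      have := hc.nonneg
      simp only [Prod.fst_neg, Prod.snd_neg] at this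
      rw [height, abs_of_nonpos (by omega)] at hz
      rw [mem_ball, abs_height_neg, height]
      simp only [Prod.fst_add, Prod.snd_add, Prod.fst_neg, Prod.snd_neg]
      rw [abs_of_nonneg (by omega)]
      omega

/-! ### Triangle counts and the final distribution. -/

open Classical in
/-- The number of triangles of the one-sided gasket that contain `z` and lie below level `n`. -/
noncomputable def cellCount (n : ℤ) (z : ℤ × ℤ) : ℝ :=
  (if IsCell z ∧ z.1 + z.2 < n then 1 else 0) +
  (if IsCell (z - (1, 0)) ∧ z.1 + z.2 ≤ n then 1 else 0) +
  (if IsCell (z - (0, 1)) ∧ z.1 + z.2 ≤ n then 1 else 0)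

open Classical in
theorem sum_cellSum_single {k : ℕ} {n : ℤ} (hn : n ≤ 2 ^ k) (z : ℤ × ℤ) :
    ∑ t ∈ cells k, (if t.1 + t.2 < n then cellSum (Pi.single z 1) t else 0) = cellCount n z := by
  have e : ∀ t : ℤ × ℤ, (if t.1 + t.2 < n then cellSum (Pi.single z 1) t else 0) =
      (if t + 0 = z then (if t.1 + t.2 < n then 1 else 0) else 0) +
      (if t + (1, 0) = z then (if t.1 + t.2 < n then 1 else 0) else 0) +
      (if t + (0, 1) = z then (if t.1 + t.2 < n then (1 : ℝ) else 0) else 0) := by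
    intro t
    simp only [cellSum, Pi.single_apply, add_zero]
    by_cases h : t.1 + t.2 < n <;> simp [h]
  have c : ∀ v : ℤ × ℤ, (if z - v ∈ cells k then
      (if (z - v).1 + (z - v).2 < n then (1 : ℝ) else 0) else 0) =
      if z - v ∈ cells k ∧ (z - v).1 + (z - v).2 < n then 1 else 0 := fun v => (ite_and _ _ _ _).symm
  simp only [e, Finset.sum_add_distrib, sum_ite_cells, c, cellCount]
  congr 1
  · congr 1
    · refine if_congr ?_ rfl rfl
      rw [sub_zero, mem_cells_iff]
      constructor
      · exact fun h => ⟨h.1.1, h.2⟩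
      · exact fun h => ⟨⟨h.1, by omega⟩, h.2⟩
    · refine if_congr ?_ rfl rfl
      rw [mem_cells_iff]
      simp only [Prod.fst_sub, Prod.snd_sub]
      constructor
      · exact fun h => ⟨h.1.1, by omega⟩
      · exact fun h => ⟨⟨h.1, by omega⟩, by omega⟩
  · refine if_congr ?_ rfl rfl
    rw [mem_cells_iff]
    simp only [Prod.fst_sub, Prod.snd_sub]
    constructor
    · exact fun h => ⟨h.1.1, by omega⟩
    · exact fun h => ⟨⟨h.1, by omega⟩, by omega⟩

theorem cellCount_eq_zero {n : ℤ} {z : ℤ × ℤ} (h : z ∉ gasketPos.verts) : cellCount n z = 0 := by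
  rw [gasketPos_verts_iff] at h
  push Not at h
  simp [cellCount, h]

-- Of the two triangles at a vertex of the ball, one lies outside exactly when the vertex is on the
-- inner boundary. The formula fails at `n = 0`, where the origin has height 1/2 but no triangle is
-- counted.
open Classical in
theorem finalSand_eq_cellCount {n : ℤ} (hn : 0 < n) (z : Vertex) :
    finalSand n z = 1 / 2 * (cellCount n z.1 + cellCount n (-z.1)) := by
  simp only [finalSand, mem_ball, mem_innerBoundary_ball hn.le]
  have key : ∀ p : ℤ × ℤ, p ∈ gasketPos.verts → p ≠ 0 →
      (|height p| ≤ n → |height p| = n → IsCell p → cellCount n p = 1) ∧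
      (|height p| ≤ n → ¬ (|height p| = n ∧ IsCell p) → cellCount n p = 2) ∧
      (¬ |height p| ≤ n → cellCount n p = 0) := by
    intro p hp h0
    have hnn := gasketPos_nonneg hp
    rw [height, abs_of_nonneg (by omega)]
    have hc := gasketPos_cases hp h0
    refine ⟨?_, ?_, ?_⟩
    · intro h1 h2 h3
      have h4 : ¬ p.1 + p.2 < n := by omega
      rcases hc with ⟨a, b, c⟩ | ⟨a, b, c⟩ | ⟨a, b, c⟩ <;> simp [cellCount, a, b, c, h1, h4]
      exact absurd h3 a
    · intro h1 h2
      have h4 : IsCell p → p.1 + p.2 < n := by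
        intro h
        have : p.1 + p.2 ≠ n := fun e => h2 ⟨e, h⟩
        omega
      rcases hc with ⟨a, b, c⟩ | ⟨a, b, c⟩ | ⟨a, b, c⟩
      · have := h4 a
        simp [cellCount, a, b, c, h1, this]
        norm_num
      · have := h4 a
        simp [cellCount, a, b, c, h1, this]
        norm_num
      · simp [cellCount, a, b, c, h1]
        norm_num
    · intro h1
      have h2 : ¬ p.1 + p.2 < n := by omega
      simp [cellCount, h1, h2]
  by_cases h0 : z.1 = 0
  · rw [h0]
    have : (0 : ℤ) ≠ n := hn.ne
    have h1 : ¬ IsCell (-1, 0) := fun h => by simpa using h.nonneg.1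
    have h2 : ¬ IsCell (0, -1) := fun h => by simpa using h.nonneg.2
    simp [cellCount, isCell_zero, height, hn.le, this, hn, h1, h2]
    norm_num
  rcases gasket_verts.1 z.2 with hp | hp
  · have hq : -z.1 ∉ gasketPos.verts := fun hq => h0 (eq_zero_of_gasketPos hp hq)
    have hc : ¬ IsCell (-z.1) := fun h => hq (isCell_pos h)
    obtain ⟨k1, k2, k3⟩ := key _ hp h0
    rw [cellCount_eq_zero hq]
    simp only [hc, or_false]
    split_ifs with h1 h2
    · rw [k1 h1 h2.1 h2.2]; norm_num
    · rw [k2 h1 h2]; norm_num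
    · rw [k3 h1]; norm_num
  · have hq : z.1 ∉ gasketPos.verts := fun hq => h0 (eq_zero_of_gasketPos hq hp)
    have hc : ¬ IsCell z.1 := fun h => hq (isCell_pos h)
    obtain ⟨k1, k2, k3⟩ := key _ hp (neg_ne_zero.2 h0)
    rw [abs_height_neg] at k1 k2 k3
    rw [cellCount_eq_zero hq]
    simp only [hc, false_or]
    split_ifs with h1 h2
    · rw [k1 h1 h2.1 h2.2]; norm_num
    · rw [k2 h1 h2]; norm_num
    · rw [k3 h1]; norm_num


/-! ### Least action and convergence of the sandpile. -/

theorem laplacian_add_mul (f g : Vertex → ℝ) (c : ℝ) (z : Vertex) :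
    laplacian (fun y => f y + c * g y) z = laplacian f z + c * laplacian g z := by
  obtain ⟨s, _, _, hs⟩ := exists_neighborFinset z
  rw [hs, hs, hs, Finset.sum_add_distrib, ← Finset.mul_sum]
  ring

theorem laplacian_pointMass_self (z : Vertex) : laplacian (pointMass z) z = -1 := by
  obtain ⟨s, _, hm, hs⟩ := exists_neighborFinset z
  rw [hs, Finset.sum_eq_zero]
  · simp [pointMass]
  · intro y hy
    have hne : y ≠ z := fun h => ((hm y).1 hy).ne h.symm
    simp [pointMass, hne]

theorem emitted_succ (μ₀ : Vertex → ℝ) (x : ℕ → Vertex) (k : ℕ) (y : Vertex) :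
    emitted μ₀ x (k + 1) y =
      emitted μ₀ x k y + max (sand μ₀ x k (x k) - 1) 0 * pointMass (x k) y := by
  rw [emitted, emitted, Finset.sum_filter, Finset.sum_filter, Finset.sum_range_succ]
  congr 1
  split_ifs with h
  · subst h
    have h1 : pointMass (x k) (x k) = 1 := Pi.single_eq_same _ _
    simp only [sand, topple, laplacian_pointMass_self, h1]
    ring
  · simp [pointMass, Ne.symm h]

theorem emitted_zero (μ₀ : Vertex → ℝ) (x : ℕ → Vertex) (y : Vertex) : emitted μ₀ x 0 y = 0 := by
  simp [emitted]

theorem sand_eq (μ₀ : Vertex → ℝ) (x : ℕ → Vertex) (k : ℕ) (z : Vertex) :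
    sand μ₀ x k z = μ₀ z + laplacian (emitted μ₀ x k) z := by
  induction k with
  | zero =>
    obtain ⟨s, _, _, hs⟩ := exists_neighborFinset z
    simp [hs, emitted_zero, sand]
  | succ k ih =>
    have : emitted μ₀ x (k + 1) = fun y =>
        emitted μ₀ x k y + max (sand μ₀ x k (x k) - 1) 0 * pointMass (x k) y :=
      funext (emitted_succ μ₀ x k)
    rw [this, laplacian_add_mul, ← add_assoc, ← ih]
    rfl

theorem emitted_le_succ (μ₀ : Vertex → ℝ) (x : ℕ → Vertex) (k : ℕ) (y : Vertex) :
    emitted μ₀ x k y ≤ emitted μ₀ x (k + 1) y := by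
  rw [emitted_succ]
  refine le_add_of_nonneg_right (mul_nonneg (le_max_right _ _) ?_)
  by_cases h : y = x k
  · subst h
    simp [pointMass]
  · simp [pointMass, h]

/-- The least action principle: the emitted mass stays below every function whose toppling
stabilizes the sandpile. -/
theorem emitted_le {μ₀ u : Vertex → ℝ} (hu : ∀ z, 0 ≤ u z)
    (hle : ∀ z, μ₀ z + laplacian u z ≤ 1) (x : ℕ → Vertex) (k : ℕ) :
    ∀ y, emitted μ₀ x k y ≤ u y := by
  induction k with
  | zero =>
    intro y
    rw [emitted_zero]
    exact hu y
  | succ k ih =>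
    intro y
    rw [emitted_succ]
    by_cases h : y = x k
    · subst h
      rcases le_total (sand μ₀ x k (x k) - 1) 0 with h0 | h0
      · rw [max_eq_right h0, zero_mul, add_zero]
        exact ih _
      -- After a genuine toppling the height is 1, so the new emitted mass is `μ₀ - 1` plus the
      -- neighbour average of the old one. The same expression for `u` is at most `u`, by `hle`.
      · rw [max_eq_left h0, sand_eq]
        obtain ⟨s, _, _, hs⟩ := exists_neighborFinset (x k)
        have h1 := hle (x k)
        have h2 : ∑ y ∈ s, emitted μ₀ x k y ≤ ∑ y ∈ s, u y := Finset.sum_le_sum fun y _ => ih y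
        rw [hs] at h1 ⊢
        simp only [pointMass, Pi.single_eq_same]
        linarith
    · simpa [pointMass, h] using ih y

theorem sand_topple_le_one (μ₀ : Vertex → ℝ) (x : ℕ → Vertex) (k : ℕ) :
    sand μ₀ x (k + 1) (x k) ≤ 1 := by
  simp only [sand, topple, laplacian_pointMass_self]
  have := le_max_left (sand μ₀ x k (x k) - 1) 0
  linarith

/-- A function that is subharmonic wherever it is positive, and positive only at finitely many
vertices, is nowhere positive. -/
theorem nonpos_of_subharmonic {w : Vertex → ℝ} (hfin : {z | 0 < w z}.Finite)
    (hsub : ∀ z, 0 < w z → 0 ≤ laplacian w z) (h0 : ∃ z, w z ≤ 0) : ∀ z, w z ≤ 0 := by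
  by_contra! hpos
  obtain ⟨z₀, hz₀, hmax⟩ := Set.exists_max_image _ w hfin hpos
  have hM : ∀ z, w z ≤ w z₀ := by
    intro z
    rcases lt_or_ge 0 (w z) with h | h
    · exact hmax z h
    · exact h.trans (le_of_lt hz₀)
  -- Where the maximum is attained the neighbour average is at least the maximum, so all four
  -- neighbours attain it too.
  have step : ∀ y z, SG.Adj y z → w y = w z₀ → w z = w z₀ := by
    intro y z hyz hy
    obtain ⟨s, hc, hm, hs⟩ := exists_neighborFinset y
    have h1 := hsub y (hy ▸ hz₀)
    rw [hs, hy] at h1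
    by_contra hne
    have hlt : ∑ v ∈ s, w v < ∑ _v ∈ s, w z₀ :=
      Finset.sum_lt_sum (fun v _ => hM v) ⟨z, (hm z).2 hyz, lt_of_le_of_ne (hM z) hne⟩
    rw [Finset.sum_const, hc, nsmul_eq_mul] at hlt
    push_cast at hlt
    linarith
  have hall : ∀ {y z} (_ : SG.Walk y z), w y = w z₀ → w z = w z₀ := by
    intro y z p
    induction p with
    | nil => exact id
    | cons h _ ih => exact fun hy => ih (step _ _ h hy)
  obtain ⟨z, hz⟩ := h0
  obtain ⟨p⟩ := connected_SG.preconnected z₀ z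
  have := hall p rfl
  rw [this] at hz
  exact absurd hz (not_le.2 hz₀)

/-- A finitely supported function that stabilizes the sandpile and is fully used on its support is
the odometer function. -/
theorem isLimitSand_and_isOdometer {μ₀ μ u : Vertex → ℝ} (hu : ∀ z, 0 ≤ u z)
    (hfin : (cluster u).Finite) (h0 : ∃ z, u z = 0) (hμ : ∀ z, μ z = μ₀ z + laplacian u z)
    (hle : ∀ z, μ z ≤ 1) (hfull : ∀ z, 0 < u z → μ z = 1) :
    IsLimitSand μ₀ μ ∧ IsOdometer μ₀ u := by
  suffices h : ∀ x, IsTopplingSequence x →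
      (∀ z, Tendsto (fun k => sand μ₀ x k z) atTop (𝓝 (μ z))) ∧
      ∀ z, Tendsto (fun k => emitted μ₀ x k z) atTop (𝓝 (u z)) from
    ⟨fun x hx => (h x hx).1, fun x hx => (h x hx).2⟩
  intro x hx
  have hbd : ∀ k y, emitted μ₀ x k y ≤ u y := emitted_le hu (fun z => hμ z ▸ hle z) x
  have hlim : ∀ z, ∃ l, Tendsto (fun k => emitted μ₀ x k z) atTop (𝓝 l) := fun z =>
    ⟨_, tendsto_atTop_ciSup (monotone_nat_of_le_succ fun k => emitted_le_succ μ₀ x k z)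
      ⟨u z, by rintro _ ⟨k, rfl⟩; exact hbd k z⟩⟩
  choose v hv using hlim
  have hvu : ∀ z, v z ≤ u z := fun z => le_of_tendsto' (hv z) fun k => hbd k z
  have hv0 : ∀ z, 0 ≤ v z := fun z => ge_of_tendsto' (hv z) fun k => by
    rw [← emitted_zero μ₀ x z]
    exact monotone_nat_of_le_succ (fun k => emitted_le_succ μ₀ x k z) (Nat.zero_le k)
  have hsand : ∀ z, Tendsto (fun k => sand μ₀ x k z) atTop (𝓝 (μ₀ z + laplacian v z)) := by
    intro z
    obtain ⟨s, _, _, hs⟩ := exists_neighborFinset z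
    simp only [sand_eq, hs]
    exact tendsto_const_nhds.add
      (((tendsto_finsetSum s fun y _ => hv y).const_mul _).sub (hv z))
  -- Each vertex has height at most 1 right after each of its infinitely many topplings, and the
  -- heights converge.
  have hone : ∀ z, μ₀ z + laplacian v z ≤ 1 := by
    intro z
    refine le_of_tendsto_of_frequently ((tendsto_add_atTop_iff_nat 1).2 (hsand z)) ?_
    refine (hx z).mono ?_
    rintro k rfl
    exact sand_topple_le_one μ₀ x k
  -- Where `u > v ≥ 0` the height under `u` is exactly 1 and under `v` at most 1, so `u - v` is
  -- subharmonic there.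
  have hw : ∀ z, u z + (-1) * v z ≤ 0 := by
    refine nonpos_of_subharmonic (hfin.subset ?_) ?_ ?_
    · intro z hz
      have h1 : 0 < u z + (-1) * v z := hz
      have := hv0 z
      change 0 < u z
      linarith
    · intro z hz
      have h1 := hfull z (by have := hv0 z; linarith)
      have h2 := hone z
      have h3 := hμ z
      rw [laplacian_add_mul]
      linarith
    · obtain ⟨z, hz⟩ := h0
      refine ⟨z, ?_⟩
      have := hv0 z
      linarith
  have huv : v = u := funext fun z => le_antisymm (hvu z) (by linarith [hw z])
  subst huv
  refine ⟨fun z => ?_, hv⟩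
  rw [hμ]
  exact hsand z

/-! ### Mass balance. -/

theorem sum_single_ball {n : ℤ} {p : ℤ × ℤ} (hp : p ∈ gasket.verts) (hn : |height p| ≤ n) :
    ∑ z ∈ (finite_ball n).toFinset, (Pi.single z.1 1 : ℤ × ℤ → ℝ) p = 1 := by
  rw [Finset.sum_eq_single ⟨p, hp⟩]
  · simp
  · intro z _ hz
    rw [Pi.single_eq_of_ne]
    rintro rfl
    exact hz rfl
  · intro h
    exact absurd ((finite_ball n).mem_toFinset.2 (mem_ball.2 hn)) h

theorem isCorner_mem_ball {n : ℤ} {k : ℕ} {t p : ℤ × ℤ} (ht : t ∈ cells k) (hn : t.1 + t.2 < n)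
    (hp : IsCorner t p) : p ∈ gasketPos.verts ∧ |height p| ≤ n := by
  have hc : IsCell t := ⟨k, ht⟩
  have hv : p ∈ gasketPos.verts := gasketPos_verts.2 ⟨t, hc, hp⟩
  have := gasketPos_nonneg hv
  refine ⟨hv, ?_⟩
  rw [height, abs_of_nonneg (by omega)]
  rcases hp with rfl | rfl | rfl
  · exact hn.le
  all_goals
    simp only [Prod.fst_add, Prod.snd_add]
    omega

/-- Double counting: each triangle below level `n` and its mirror image have three corners each, all
inside the ball. -/
theorem sum_cellCount {n : ℤ} {k : ℕ} (hk : n ≤ 2 ^ k) :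
    ∑ z ∈ (finite_ball n).toFinset, (cellCount n z.1 + cellCount n (-z.1)) =
      ∑ t ∈ cells k, if t.1 + t.2 < n then 6 else 0 := by
  simp only [← sum_cellSum_single hk, ← Finset.sum_add_distrib]
  rw [Finset.sum_comm]
  refine Finset.sum_congr rfl fun t ht => ?_
  by_cases hlt : t.1 + t.2 < n
  · simp only [hlt, if_true]
    have h1 : ∀ p, IsCorner t p →
        ∑ z ∈ (finite_ball n).toFinset, (Pi.single z.1 1 : ℤ × ℤ → ℝ) p = 1 := fun p hp =>
      sum_single_ball (gasket_verts.2 (Or.inl (isCorner_mem_ball ht hlt hp).1))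
        (isCorner_mem_ball ht hlt hp).2
    have h2 : ∀ p, IsCorner t p →
        ∑ z ∈ (finite_ball n).toFinset, (Pi.single (-z.1) 1 : ℤ × ℤ → ℝ) p = 1 := by
      intro p hp
      have h := isCorner_mem_ball ht hlt hp
      refine Eq.trans (Finset.sum_congr rfl fun z _ => ?_) (sum_single_ball (p := -p)
        (gasket_verts.2 (Or.inr (by rw [neg_neg]; exact h.1)))
        (by rw [abs_height_neg]; exact h.2))
      simp only [Pi.single_apply, neg_eq_iff_eq_neg, eq_neg_iff_add_eq_zero]
    simp only [cellSum, Finset.sum_add_distrib]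
    rw [h1 _ (Or.inl rfl), h1 _ (Or.inr (Or.inl rfl)), h1 _ (Or.inr (Or.inr rfl)),
      h2 _ (Or.inl rfl), h2 _ (Or.inr (Or.inl rfl)), h2 _ (Or.inr (Or.inr rfl))]
    norm_num
  · simp [hlt]

theorem sum_finalSand (n : ℤ) :
    ∑ z ∈ (finite_ball n).toFinset, finalSand n z = ballMass n := by
  classical
  have hsub : innerBoundary (ball n) ⊆ ball n := fun _ h => h.1
  have hb : (innerBoundary (ball n)).ncard =
      ((finite_ball n).toFinset.filter (· ∈ innerBoundary (ball n))).card := by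
    rw [← Set.ncard_coe_finset]
    congr 1
    ext z
    simp only [Finset.coe_filter, Set.Finite.mem_toFinset, Set.mem_ofPred_eq]
    exact ⟨fun h => ⟨hsub h, h⟩, fun h => h.2⟩
  rw [ballMass, hb, Set.ncard_eq_toFinset_card _ (finite_ball n), Finset.card_filter,
    Finset.card_eq_sum_ones]
  push_cast
  rw [Finset.mul_sum, ← Finset.sum_sub_distrib]
  refine Finset.sum_congr rfl fun z hz => ?_
  rw [finalSand, if_pos ((finite_ball n).mem_toFinset.1 hz)]
  split_ifs <;> norm_num

theorem finalSand_le_one (n : ℤ) (z : Vertex) : finalSand n z ≤ 1 := by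
  rw [finalSand]
  split_ifs <;> norm_num

/-- Supplies a vertex at every distance from the origin, hence a zero of the odometer for the
maximum principle. -/
theorem isCell_natCast (m : ℕ) : IsCell ((m : ℤ), 0) := by
  induction m using Nat.strong_induction_on with
  | _ m ih =>
    rcases Nat.eq_zero_or_pos m with rfl | hm
    · exact isCell_zero
    · rw [isCell_iff_half]
      exact ⟨by simpa using ih (m / 2) (by omega), Or.inr rfl⟩

/-! ### The two-sided odometer and the theorem. -/

/-- The odometer function for positive radius. -/
theorem exists_odometer {n : ℕ} (hn : 0 < n) : ∃ u : Vertex → ℝ,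
    (∀ z, (n : ℤ) ≤ |height z.1| → u z = 0) ∧ (∀ z, |height z.1| < n → 0 < u z) ∧
    ∀ z, finalSand n z = ballMass n * pointMass origin z + laplacian u z := by
  have hk : (n : ℤ) < 2 ^ n := by exact_mod_cast Nat.lt_two_pow_self
  obtain ⟨V, β, V0, V1, Ve⟩ := exists_potential n n hk.le
  set U : ℤ × ℤ → ℝ := fun p => if 0 ≤ p.1 + p.2 then V p else V (-p) with hU
  have U0 : ∀ p : ℤ × ℤ, (n : ℤ) ≤ |height p| → U p = 0 := by
    intro p hp
    simp only [hU]
    split_ifs with h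
    · rw [height, abs_of_nonneg h] at hp
      exact V0 p hp
    · rw [height, abs_of_nonpos (by omega)] at hp
      exact V0 _ (by simp only [Prod.fst_neg, Prod.snd_neg]; omega)
  have U1 : ∀ p : ℤ × ℤ, |height p| < n → 0 < U p := by
    intro p hp
    simp only [hU]
    split_ifs with h
    · rw [height, abs_of_nonneg h] at hp
      exact V1 p hp
    · rw [height, abs_of_nonpos (by omega)] at hp
      exact V1 _ (by simp only [Prod.fst_neg, Prod.snd_neg]; omega)
  have Upos : ∀ h, ∑ t ∈ cells n, cellForm U h t = ∑ t ∈ cells n, cellForm V h t := fun h =>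
    Finset.sum_congr rfl fun t ht => cellForm_congr ht fun p p1 p2 _ => by
      simp only [hU, add_nonneg p1 p2, if_true]
  have Uneg : ∀ h, ∑ t ∈ cells n, cellForm (fun p => U (-p)) h t =
      ∑ t ∈ cells n, cellForm V h t := fun h =>
    Finset.sum_congr rfl fun t ht => cellForm_congr ht fun p p1 p2 _ => by
      simp only [hU, Prod.fst_neg, Prod.snd_neg, neg_neg]
      split_ifs with h
      · have : p = 0 := by
          ext
          · simp only [Prod.fst_zero]; omega
          · simp only [Prod.snd_zero]; omega
        rw [this, neg_zero]
      · rfl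
  -- Testing against `h = 1` makes the energy vanish, so `β` equals the total triangle charge, which
  -- is twice the mass of `finalSand n`.
  have hβ : β = 2 * ballMass n := by
    have h1 := Ve fun _ => 1
    have h2 : ∑ t ∈ cells n, cellForm V (fun _ => 1) t = 0 := Finset.sum_eq_zero fun t _ => by
      simp only [cellForm]
      ring
    have h3 : ∀ t : ℤ × ℤ, (if t.1 + t.2 < n then (6 : ℝ) else 0) =
        2 * if t.1 + t.2 < n then cellSum (fun _ => 1) t else 0 := by
      intro t
      split_ifs <;> norm_num [cellSum]
    rw [← sum_finalSand]
    simp only [finalSand_eq_cellCount (n := n) (by omega)]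
    rw [← Finset.mul_sum, sum_cellCount hk.le]
    simp only [h3]
    rw [← Finset.mul_sum]
    linarith
  refine ⟨fun z => U z.1, fun z hz => U0 _ hz, fun z hz => U1 _ hz, fun z => ?_⟩
  rcases lt_or_ge |height z.1| (2 ^ n) with hz | hz
  · have hz' := abs_lt.1 hz
    rw [height] at hz'
    have hz2 : (-z.1).1 + (-z.1).2 < (2 : ℤ) ^ n := by
      simp only [Prod.fst_neg, Prod.snd_neg]
      omega
    rw [laplacian_eq_cellLap, ← sum_cellForm_single U hz'.2, ← sum_cellForm_single _ hz2, Upos,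
      Uneg, Ve, Ve, sum_cellSum_single hk.le, sum_cellSum_single hk.le,
      finalSand_eq_cellCount (by omega), hβ]
    have hs : ∀ p : ℤ × ℤ, p = z.1 ∨ p = -z.1 →
        (Pi.single p 1 : ℤ × ℤ → ℝ) 0 = pointMass origin z := by
      intro p hp
      by_cases h : z = origin
      · subst h
        have : p = 0 := by
          rcases hp with rfl | rfl
          · rfl
          · exact neg_zero
        subst this
        simp [pointMass]
      · have hz0 : z.1 ≠ 0 := fun h' => h (Subtype.ext h')
        have : p ≠ 0 := by
          rcases hp with rfl | rfl
          · exact hz0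
          · exact neg_ne_zero.2 hz0
        simp [pointMass, h, this.symm]
    rw [hs _ (Or.inl rfl), hs _ (Or.inr rfl)]
    ring
  -- Since `2 ^ n > n`, such a vertex and all its neighbours are at distance at least `n`, where `u`
  -- vanishes.
  · have hne : z ≠ origin := by
      rintro rfl
      have : height origin.1 = 0 := rfl
      rw [this, abs_zero] at hz
      omega
    have hb : z ∉ ball (n : ℤ) := fun h => by
      rw [mem_ball] at h
      omega
    obtain ⟨s, _, hm, hs⟩ := exists_neighborFinset z
    rw [finalSand, if_neg hb, hs, Finset.sum_eq_zero, U0 _ (by omega)]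
    · simp [pointMass, hne]
    · intro y hy
      have := height_adj (SG_adj.1 ((hm y).1 hy).symm)
      exact U0 _ (by omega)

theorem ball_zero : ball 0 = {origin} := by
  ext z
  rw [mem_ball, Set.mem_singleton_iff]
  constructor
  · intro h
    by_contra hne
    have hz0 : z.1 ≠ 0 := fun h' => hne (Subtype.ext h')
    obtain ⟨y, _, hy⟩ := exists_lower hz0
    have := abs_nonneg (height y.1)
    omega
  · rintro rfl
    rfl

theorem finalSand_of_nonpos {n : ℤ} (hn : n ≤ 0) (z : Vertex) :
    finalSand n z = ballMass n * pointMass origin z := by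
  rcases hn.lt_or_eq with hn | rfl
  · have : ball n = ∅ := by
      ext z
      rw [mem_ball]
      have := abs_nonneg (height z.1)
      simp only [Set.mem_empty_iff_false, iff_false]
      omega
    simp [finalSand, ballMass, this, innerBoundary]
  · have hb : innerBoundary (ball 0) = {origin} := by
      ext z
      rw [mem_innerBoundary_ball le_rfl, Set.mem_singleton_iff]
      constructor
      · rintro ⟨h, _⟩
        have : z ∈ ball 0 := mem_ball.2 h.le
        rwa [ball_zero] at this
      · rintro rfl
        exact ⟨rfl, Or.inl isCell_zero⟩
    rw [ball_zero] at hb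
    by_cases h : z = origin
    · simp [finalSand, ballMass, hb, ball_zero, h, pointMass]
      norm_num
    · simp [finalSand, ball_zero, h, pointMass]

end GasketSandpile

theorem mainTheorem2 (n : ℤ) :
    GasketSandpile.IsLimitSand
        (fun z => GasketSandpile.ballMass n * GasketSandpile.pointMass GasketSandpile.origin z)
        (GasketSandpile.finalSand n) ∧
      ∃ u : GasketSandpile.Vertex → ℝ,
        GasketSandpile.IsOdometer
            (fun z => GasketSandpile.ballMass n * GasketSandpile.pointMass GasketSandpile.origin z)
            u ∧
          GasketSandpile.cluster u = GasketSandpile.ball (n - 1) := by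
  open GasketSandpile in
  rcases le_or_gt n 0 with hn | hn
  -- The initial mass is 0 for `n < 0` and 1/2 for `n = 0`, so nothing topples and the odometer is
  -- zero.
  · have h := isLimitSand_and_isOdometer (μ₀ := fun z => ballMass n * pointMass origin z)
      (μ := finalSand n) (u := fun _ => 0) (fun _ => le_rfl) (by simp [cluster]) ⟨origin, rfl⟩
      (fun z => by
        obtain ⟨s, _, _, hs⟩ := exists_neighborFinset z
        rw [hs, finalSand_of_nonpos hn]
        simp) (finalSand_le_one n) (fun z hz => absurd hz (lt_irrefl 0))
    refine ⟨h.1, _, h.2, ?_⟩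
    ext z
    rw [mem_ball]
    have := abs_nonneg (height z.1)
    simp only [cluster, lt_self_iff_false, Set.mem_ofPred_eq, false_iff]
    omega
  · obtain ⟨m, rfl⟩ := Int.eq_ofNat_of_zero_le hn.le
    obtain ⟨u, u0, u1, hu⟩ := exists_odometer (n := m) (by omega)
    have hcl : cluster u = ball (m - 1) := by
      ext z
      rw [mem_ball]
      change 0 < u z ↔ _
      rcases lt_or_ge |height z.1| (m : ℤ) with h | h
      · exact ⟨fun _ => by omega, fun _ => u1 z h⟩
      · rw [u0 z h]
        exact ⟨fun h' => absurd h' (lt_irrefl 0), fun h' => by omega⟩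
    have h := isLimitSand_and_isOdometer (μ₀ := fun z => ballMass m * pointMass origin z)
      (μ := finalSand m) (u := u) (fun z => by
        rcases lt_or_ge |height z.1| (m : ℤ) with h | h
        · exact (u1 z h).le
        · exact (u0 z h).ge) (hcl ▸ finite_ball _) ?_ hu (finalSand_le_one m) ?_
    · exact ⟨h.1, u, h.2, hcl⟩
    · have hc := isCell_natCast m
      refine ⟨⟨_, gasket_verts.2 (Or.inl (isCell_pos hc))⟩, u0 _ ?_⟩
      simp [height]
    · intro z hz
      have hz' : z ∈ ball ((m : ℤ) - 1) := hcl ▸ hz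
      rw [mem_ball] at hz'
      have hb : z ∈ ball (m : ℤ) := mem_ball.2 (by omega)
      have hi : z ∉ innerBoundary (ball (m : ℤ)) := fun h => by
        rw [mem_innerBoundary_ball (by omega)] at h
        omega
      rw [finalSand, if_pos hb, if_neg hi]
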